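/- \textbf{Theorem 2.} All logarithms are to base $2$. Let $\mathcal U$ be a finite group of order $J$, written additively, let $\mathcal V=\mathcal U$ (so $M:=|\mathcal V|=J$), and let $\varrho:\mathcal U\to[0,\infty)$ define the difference distortion $\rho(u,v)=\varrho(v-u)$. For real $D\ge\min\varrho$ let $\Phi(D)$ be the maximum of the entropy $H(W)$ over all $\mathcal U$-valued random variables $W$ with $\mathbf E\varrho(W)\le D$, and let $$\Psi(x)=\begin{cases}0,&x<0,\\ \Phi^{-1}(x):=\inf\{D\ge\min\varrho:\ \Phi(D)\ge x\},&x\ge0,\end{cases}$$ with $\inf\emptyset=+\infty$. Let $\mathcal X,\mathcal Y$ be finite alphabets of sizes $K,L$ and let $P(y|x)$ be a discrete memoryless channel from $\mathcal X$ to $\mathcal Y$ with capacity $C=\max_{P_X}I(X;Y)$. Let $\ell\ge1$ and $n\ge2$ with $\ell\mid n$. A deterministic sequence $u^n\in\mathcal U^n$ is mapped by an arbitrary encoder into $x^n\in\mathcal X^n$, which is sent through the channel; its output is $Y^n$. A decoder with a finite set $\mathcal Z$ of $s$ states, a modulo-$\ell$ counter and delay $d$ has an initial state $z_1\in\mathcal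 Z$ and functions $f_\tau:\mathcal Z\times\mathcal Y\to\mathcal V$, $g_\tau:\mathcal Z\times\mathcal Y\to\mathcal Z$ ($0\le\tau<\ell$), and works by $$V_{t-d}=f_{t\bmod\ell}(z_t,Y_t)\ (d+1\le t\le n),\qquad z_{t+1}=g_{t\bmod \ell}(z_t,Y_t)\ (t\ge1);$$ the remaining symbols $V_t$, $n-d<t\le n$, are arbitrary symbols of $\mathcal V$ (possibly depending on $Y^n$). Let $c(u^n)$ be the number of phrases of the Lempel--Ziv incremental parsing of $u^n$ (each phrase is the shortest string that differs from all earlier phrases; a last, incomplete phrase counts). Then $$\frac1n\sum_{t=1}^n\mathbf E\{\varrho(V_t-u_t)\}\ \ge\ \Psi\!\left(\frac{c(u^n)\log c(u^n)}{n}-C-\frac{2\log s+d\log M}{\ell}-\delta_2(\ell,n)\right),$$ where $$\delta_2(\ell,n)=\delta_1(\ell,n)+\frac{2\ell(1+\log J)^2}{(1-\epsilon_n)\log n}+\frac{2\ell J^{2\ell}\log J}{n}+\frac1\ell,$$ $$\delta_1(\ell,n)=\frac{(JK)^\ell\log L}{\sqrt n}+\frac{(JKL)^\ell\log e}{2n}+o\!\left(\frac1{\sqrt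 n}\right).$$ Here $(\epsilon_n)$ is a sequence in $(0,1)$ that tends to $0$ and depends only on $J$, and the $o(1/\sqrt n)$ term ($n\to\infty$) depends only on $J,K,L,\ell$ and $n$; both are the same for all $u^n$, encoders, channels, decoders, delays, numbers of states and distortion functions $\varrho$. -/

import Mathlib

namespace SemiDet

noncomputable section

/-- Shannon entropy, in bits, of a probability vector on a finite alphabet. -/
def entropy {A : Type*} [Fintype A] (p : A → ℝ) : ℝ :=
  -∑ a, p a * Real.logb 2 (p a)

/-- A discrete memoryless channel is given by its single-letter transition probabilities
`P x y = P(y|x)`; every row is a probability vector. -/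
def IsChannel {X Y : Type*} [Fintype Y] (P : X → Y → ℝ) : Prop :=
  ∀ x, P x ∈ stdSimplex ℝ Y

/-- Mutual information `I(X;Y) = H(Y) - H(Y|X)` for the input law `p` and the channel `P`. -/
def mutualInfo {X Y : Type*} [Fintype X] [Fintype Y] (p : X → ℝ) (P : X → Y → ℝ) : ℝ :=
  entropy (fun y => ∑ x, p x * P x y) - ∑ x, p x * entropy (P x)

/-- Channel capacity: the maximum of `I(X;Y)` over all input laws. -/
def capacity {X Y : Type*} [Fintype X] [Fintype Y] (P : X → Y → ℝ) : ℝ :=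
  sSup ((fun p => mutualInfo p P) '' stdSimplex ℝ X)

/-- Expectation of `F(Y^n)`, where `Y^n` is the output of the memoryless channel `P` fed by the
deterministic input `x^n`. -/
def expect {X Y : Type*} [Fintype Y] {n : ℕ} (P : X → Y → ℝ) (x : Fin n → X)
    (F : (Fin n → Y) → ℝ) : ℝ :=
  ∑ y : Fin n → Y, (∏ t, P (x t) (y t)) * F y

/-- A finite-state decoder with state set `Z`, initial state `z_1 = init`, and output and
next-state functions `f_τ = out τ`, `g_τ = next τ`. The index `τ` is the value of a counter. -/
structure Decoder (Z Y V : Type*) where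
  init : Z
  out : ℕ → Z → Y → V
  next : ℕ → Z → Y → Z

/-- `D.state ℓ y i` is the state `z_{i+1}` when the counter is modulo `ℓ` and the channel
output is `y^n` (entry `i` of `y` is `y_{i+1}`): `z_1 = init` and
`z_{t+1} = g_{t mod ℓ}(z_t, y_t)` for `1 ≤ t ≤ n`. Later states are never used. -/
def Decoder.state {Z Y V : Type*} (D : Decoder Z Y V) (ℓ : ℕ) {n : ℕ} (y : Fin n → Y) : ℕ → Z
  | 0 => D.init
  | i + 1 =>
    if h : i < n then D.next ((i + 1) % ℓ) (D.state ℓ y i) (y ⟨i, h⟩) else D.state ℓ y i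

/-- The reconstruction `v^n` with delay `d` (entry `j` is `v_{j+1}`):
`v_{t-d} = f_{t mod ℓ}(z_t, y_t)` for `d + 1 ≤ t ≤ n`. The last `d` symbols, which are not yet
decoded at time `n`, are the arbitrary symbols given by `tail`. -/
def Decoder.recon {Z Y V : Type*} (D : Decoder Z Y V) (ℓ d : ℕ) {n : ℕ}
    (tail : (Fin n → Y) → Fin n → V) (y : Fin n → Y) (j : Fin n) : V :=
  if h : (j : ℕ) + d < n then
    D.out ((j + d + 1) % ℓ) (D.state ℓ y (j + d)) (y ⟨j + d, h⟩)
  else tail y j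

/-- `Φ(D)`: the maximum entropy of a random variable `W` with `E ϱ(W) ≤ D`. -/
def maxEntropy {U : Type*} [Fintype U] (ϱ : U → ℝ) (D : ℝ) : ℝ :=
  sSup (entropy '' {p | p ∈ stdSimplex ℝ U ∧ ∑ w, p w * ϱ w ≤ D})

/-- The set of `D` in the domain of `Φ` (the constraint `E ϱ(W) ≤ D` is feasible) with
`Φ(D) ≥ x`. -/
def levelSet {U : Type*} [Fintype U] (ϱ : U → ℝ) (x : ℝ) : Set ℝ :=
  {D | (∃ p ∈ stdSimplex ℝ U, ∑ w, p w * ϱ w ≤ D) ∧ x ≤ maxEntropy ϱ D}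

/-- `Ψ(x) = 0` for `x < 0` and `Ψ(x) = Φ⁻¹(x)` for `x ≥ 0`, where
`Φ⁻¹(x) = inf {D | Φ(D) ≥ x}`. The value is `⊤` when `x` exceeds every value of `Φ`. -/
def psi {U : Type*} [Fintype U] (ϱ : U → ℝ) (x : ℝ) : EReal :=
  if x < 0 then 0 else sInf ((fun D : ℝ => (D : EReal)) '' levelSet ϱ x)

/-- `δ₁(ℓ,n)`, where `r` is the value at `n` of the `o(1/√n)` term. -/
def delta1 (J K L ℓ n : ℕ) (r : ℝ) : ℝ :=
  ((J : ℝ) * K) ^ ℓ * Real.logb 2 L / √(n : ℝ)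
    + ((J : ℝ) * K * L) ^ ℓ * Real.logb 2 (Real.exp 1) / (2 * n) + r

/-- `δ₂(ℓ,n)`, where `r` is the value at `n` of the `o(1/√n)` term of `δ₁`, and `ε` is `ε_n`. -/
def delta2 (J K L ℓ n : ℕ) (r ε : ℝ) : ℝ :=
  delta1 J K L ℓ n r
    + 2 * ℓ * (1 + Real.logb 2 J) ^ 2 / ((1 - ε) * Real.logb 2 n)
    + 2 * ℓ * (J : ℝ) ^ (2 * ℓ) * Real.logb 2 J / n
    + 1 / ℓ

end

/-- Incremental parsing, with `done` the list of phrases already completed, `cur` the part of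
the current phrase read so far and the last argument the unread rest. A phrase is completed as
soon as it differs from all earlier phrases. The last phrase may remain incomplete; it is kept
as a phrase if it is nonempty. -/
def lzParseAux {A : Type*} [DecidableEq A] :
    List (List A) → List A → List A → List (List A)
  | done, cur, [] => if cur = [] then done else done ++ [cur]
  | done, cur, a :: rest =>
    if cur ++ [a] ∈ done then lzParseAux done (cur ++ [a]) rest
    else lzParseAux (done ++ [cur ++ [a]]) [] rest

/-- The phrases of the Lempel–Ziv incremental parsing. -/
def lzParse {A : Type*} [DecidableEq A] (w : List A) : List (List A) :=
  lzParseAux [] [] w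

/-- `c(u^n)`: the number of phrases of the incremental parsing of `u^n`. -/
def lzCount {A : Type*} [DecidableEq A] {n : ℕ} (u : Fin n → A) : ℕ :=
  (lzParse (List.ofFn u)).length

end SemiDet

/-!
Cut the source, the channel output and the reconstruction into `k = n / ℓ` blocks and choose a
block index uniformly at random. Given the decoder state at the beginning of its block, the `d`
symbols decoded too late and the channel outputs of the block, the reconstructed block is
determined, so it carries at most `log s + d log M + ℓ C` bits about the block index. The source
block is determined by the index, and also by the reconstruction together with the error, whose
entropy is at most `ℓ` times that of the average single-letter error `W`, and `E ϱ(W)` is exactly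
the distortion. Hence the entropy of the empirical law of the source blocks is at most
`ℓ (H(W) + C) + log s + d log M`.

Conversely, this empirical block entropy dominates `c log c / k` up to small terms. The empirical
block law is a finite-state source whose state is the prefix of the current block. Discounted by
`1 - 1 / (2ℓ)` per letter, its conditional probabilities give distinct phrases a total weight of at
most `2ℓ` for each starting state, and concavity of the logarithm turns this into a bound on
`c log c`. The number of states costs `O(ℓ (1 + log J))` bits per phrase, which is absorbed by
`2ℓ (1 + log J)² / log n` because `c ≤ 1.2 (1 + log J) n / log n` for large `n`; the finitely many
remaining `n` go into the `o(1 / √n)` term.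
-/

namespace SemiDet

section Entropy

variable {A B : Type*} [Fintype A] [Fintype B]

lemma logb_two_natCast_nonneg (n : ℕ) : 0 ≤ Real.logb 2 n :=
  div_nonneg (Real.log_natCast_nonneg n) (Real.log_nonneg one_le_two)

lemma entropy_eq_sum_negMulLog (p : A → ℝ) :
    entropy p = (∑ a, Real.negMulLog (p a)) / Real.log 2 := by
  simp only [entropy, Real.negMulLog, Real.logb, Finset.sum_div, ← Finset.sum_neg_distrib]
  exact Finset.sum_congr rfl fun a _ => by ring

lemma entropy_nonneg {p : A → ℝ} (hp : p ∈ stdSimplex ℝ A) : 0 ≤ entropy p := by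
  rw [entropy_eq_sum_negMulLog]
  refine div_nonneg (Finset.sum_nonneg fun a _ => Real.negMulLog_nonneg (hp.1 a) ?_)
    (Real.log_nonneg one_le_two)
  exact hp.2 ▸ Finset.single_le_sum (fun a _ => hp.1 a) (Finset.mem_univ a)

lemma gibbs_inequality {p g : A → ℝ} (hp : p ∈ stdSimplex ℝ A) (hg : ∀ a, 0 ≤ g a)
    (hsum : ∑ a, g a ≤ 1) (hpg : ∀ a, g a = 0 → p a = 0) :
    entropy p ≤ -∑ a, p a * Real.logb 2 (g a) := by
  have hterm : ∀ a, p a * Real.log (g a) - p a * Real.log (p a) ≤ g a - p a := by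
    intro a
    rcases (hp.1 a).eq_or_lt with h | hpa
    · simpa [← h] using hg a
    · have hga : 0 < g a := (hg a).lt_of_ne fun h => hpa.ne' (hpg a h.symm)
      have hlog := Real.log_le_sub_one_of_pos (div_pos hga hpa)
      rw [Real.log_div hga.ne' hpa.ne'] at hlog
      calc p a * Real.log (g a) - p a * Real.log (p a)
          = p a * (Real.log (g a) - Real.log (p a)) := by ring
        _ ≤ p a * (g a / p a - 1) := by gcongr
        _ = g a - p a := by field_simp
  have htot : ∑ a, p a * Real.log (g a) ≤ ∑ a, p a * Real.log (p a) := by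
    have h := Finset.sum_le_sum fun a (_ : a ∈ Finset.univ) => hterm a
    rw [Finset.sum_sub_distrib, Finset.sum_sub_distrib, hp.2] at h
    linarith
  simp only [entropy, Real.logb, mul_div_assoc', ← Finset.sum_div]
  gcongr

lemma entropy_le_logb_card {p : A → ℝ} (hp : p ∈ stdSimplex ℝ A) :
    entropy p ≤ Real.logb 2 (Fintype.card A) := by
  have hA : (Fintype.card A : ℝ) ≠ 0 := by
    intro h
    have : IsEmpty A := Fintype.card_eq_zero_iff.1 (by exact_mod_cast h)
    simpa using hp.2
  refine (gibbs_inequality (g := fun _ => (Fintype.card A : ℝ)⁻¹) hp (fun _ => by positivity)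
    (by simp [hA]) (fun _ h => absurd h (inv_ne_zero hA))).trans_eq ?_
  rw [← Finset.sum_mul, hp.2, Real.logb_inv]
  ring

lemma entropy_chain_rule (w : A → ℝ) {q : A → B → ℝ} (hq : ∀ a, ∑ b, q a b = 1) :
    entropy (fun c : A × B => w c.1 * q c.1 c.2) = entropy w + ∑ a, w a * entropy (q a) := by
  simp only [entropy_eq_sum_negMulLog, Fintype.sum_prod_type, Real.negMulLog_mul,
    Finset.sum_add_distrib, ← Finset.sum_mul, ← Finset.mul_sum, hq, one_mul, mul_div_assoc',
    ← Finset.sum_div, add_div]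

lemma psi_le_of_le_entropy {ϱ : A → ℝ} (hϱ : ∀ w, 0 ≤ ϱ w) {q : A → ℝ} (hq : q ∈ stdSimplex ℝ A)
    {x : ℝ} (hx : x ≤ entropy q) : psi ϱ x ≤ ((∑ w, q w * ϱ w : ℝ) : EReal) := by
  unfold psi
  split_ifs
  · exact_mod_cast Finset.sum_nonneg fun w _ => mul_nonneg (hq.1 w) (hϱ w)
  · refine sInf_le ⟨_, ⟨⟨q, hq, le_rfl⟩, hx.trans ?_⟩, rfl⟩
    refine le_csSup ⟨Real.logb 2 (Fintype.card A), ?_⟩ ⟨q, ⟨hq, le_rfl⟩, rfl⟩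
    rintro _ ⟨p, hp, rfl⟩
    exact entropy_le_logb_card hp.1

end Entropy

section RandomVariables

variable {Ω A B C ι : Type*} [Fintype Ω] {μ : Ω → ℝ}

open scoped Classical in
/-- The law of the random variable `f` on the finite space `Ω` with weights `μ`. -/
noncomputable def law (μ : Ω → ℝ) (f : Ω → A) (a : A) : ℝ :=
  ∑ ω with f ω = a, μ ω

/-- The entropy, in bits, of the random variable `f`. It is written as an average over `Ω`, and not
as `entropy (law μ f)`, so that the alphabet needs no `Fintype` structure. -/
noncomputable def rvEntropy (μ : Ω → ℝ) (f : Ω → A) : ℝ :=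
  -∑ ω, μ ω * Real.logb 2 (law μ f (f ω))

/-- The mutual information `I(f; g)`, in bits, of two random variables on the same space. -/
noncomputable def rvMutualInfo (μ : Ω → ℝ) (f : Ω → A) (g : Ω → B) : ℝ :=
  rvEntropy μ f + rvEntropy μ g - rvEntropy μ (fun ω => (f ω, g ω))

lemma law_nonneg (hμ : ∀ ω, 0 ≤ μ ω) (f : Ω → A) (a : A) : 0 ≤ law μ f a :=
  Finset.sum_nonneg fun ω _ => hμ ω

lemma le_law (hμ : ∀ ω, 0 ≤ μ ω) (f : Ω → A) (ω : Ω) : μ ω ≤ law μ f (f ω) :=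
  Finset.single_le_sum (f := μ) (fun ω _ => hμ ω) (by simp)

lemma law_le_law_of_factorsThrough (hμ : ∀ ω, 0 ≤ μ ω) {f : Ω → A} {g : Ω → B}
    (hgf : g.FactorsThrough f) (ω : Ω) : law μ f (f ω) ≤ law μ g (g ω) := by
  refine Finset.sum_le_sum_of_subset_of_nonneg (fun ω' hω' => ?_) fun ω _ _ => hμ ω
  simp only [Finset.mem_filter_univ] at hω' ⊢
  exact hgf hω'

lemma sum_law_mul [Fintype A] (μ : Ω → ℝ) (f : Ω → A) (F : A → ℝ) :
    ∑ a, law μ f a * F a = ∑ ω, μ ω * F (f ω) := by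
  classical
  rw [← Finset.sum_fiberwise (s := Finset.univ) (g := f)]
  refine Finset.sum_congr rfl fun a _ => ?_
  rw [law, Finset.sum_mul]
  refine Finset.sum_congr (by congr) fun ω hω => ?_
  rw [(Finset.mem_filter_univ ω).1 hω]

lemma law_mem_stdSimplex [Fintype A] (hμ : μ ∈ stdSimplex ℝ Ω) (f : Ω → A) :
    law μ f ∈ stdSimplex ℝ A :=
  ⟨law_nonneg hμ.1 f, by simpa [hμ.2] using sum_law_mul μ f fun _ => 1⟩

lemma law_comp [Fintype A] (μ : Ω → ℝ) (f : Ω → A) (g : A → B) :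
    law μ (fun ω => g (f ω)) = law (law μ f) g := by
  classical
  ext b
  have h := sum_law_mul μ f fun a => if g a = b then 1 else 0
  simp only [mul_ite, mul_one, mul_zero] at h
  simp only [law, Finset.sum_filter] at h ⊢
  exact h.symm

lemma law_comp_of_injective (μ : Ω → ℝ) (f : Ω → A) {g : A → B} (hg : g.Injective) (a : A) :
    law μ (fun ω => g (f ω)) (g a) = law μ f a := by
  classical
  exact Finset.sum_congr (Finset.filter_congr fun _ _ => hg.eq_iff) fun _ _ => rfl

lemma law_compProd [Fintype A] [Fintype B] (w : A → ℝ) (q : A → B → ℝ) (f : A × B → C) (c : C) :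
    law (fun ω : A × B => w ω.1 * q ω.1 ω.2) f c = ∑ a, w a * law (q a) (fun b => f (a, b)) c := by
  simp only [law, Finset.sum_filter, Fintype.sum_prod_type, Finset.mul_sum, mul_ite, mul_zero]

lemma entropy_law [Fintype A] (μ : Ω → ℝ) (f : Ω → A) : entropy (law μ f) = rvEntropy μ f := by
  rw [entropy, rvEntropy, sum_law_mul μ f fun a => Real.logb 2 (law μ f a)]

lemma rvEntropy_comp [Fintype A] (μ : Ω → ℝ) (f : Ω → A) (g : A → B) :
    rvEntropy μ (fun ω => g (f ω)) = rvEntropy (law μ f) g := by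
  rw [rvEntropy, rvEntropy, law_comp, sum_law_mul μ f fun a => Real.logb 2 (law _ g (g a))]

lemma rvEntropy_le_logb_card [Fintype A] (hμ : μ ∈ stdSimplex ℝ Ω) (f : Ω → A) :
    rvEntropy μ f ≤ Real.logb 2 (Fintype.card A) :=
  entropy_law μ f ▸ entropy_le_logb_card (law_mem_stdSimplex hμ f)

lemma rvEntropy_le_of_factorsThrough (hμ : ∀ ω, 0 ≤ μ ω) {f : Ω → A} {g : Ω → B}
    (hgf : g.FactorsThrough f) : rvEntropy μ g ≤ rvEntropy μ f := by
  refine neg_le_neg (Finset.sum_le_sum fun ω _ => ?_)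
  rcases (hμ ω).eq_or_lt with h | h
  · simp [← h]
  · have hpos := h.trans_le (le_law hμ f ω)
    gcongr
    · norm_num
    · exact law_le_law_of_factorsThrough hμ hgf ω

lemma rvEntropy_le_of_reference [Fintype A] (hμ : μ ∈ stdSimplex ℝ Ω) (f : Ω → A) {g : A → ℝ}
    (hg : ∀ a, 0 ≤ g a) (hsum : ∑ a, g a ≤ 1) (hpos : ∀ ω, 0 < μ ω → 0 < g (f ω)) :
    rvEntropy μ f ≤ -∑ ω, μ ω * Real.logb 2 (g (f ω)) := by
  rw [← entropy_law, ← sum_law_mul μ f fun a => Real.logb 2 (g a)]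
  classical
  refine gibbs_inequality (law_mem_stdSimplex hμ f) hg hsum fun a ha => ?_
  refine Finset.sum_eq_zero fun ω hω => (hμ.1 ω).antisymm' (not_lt.1 fun h => ?_)
  rw [Finset.mem_filter_univ] at hω
  exact (hpos ω h).ne' (hω ▸ ha)

lemma sum_law_prodMk [Fintype A] (μ : Ω → ℝ) (f : Ω → A) (h : Ω → C) (c : C) :
    ∑ a, law μ (fun ω => (f ω, h ω)) (a, c) = law μ h c := by
  classical
  unfold law
  rw [← Finset.sum_fiberwise (s := Finset.univ.filter fun ω => h ω = c) (g := f)]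
  refine Finset.sum_congr rfl fun a _ => Finset.sum_congr ?_ fun _ _ => rfl
  ext ω
  simp [and_comm]

lemma sum_law_mul_law_div_law [Fintype A] [Fintype B] [Fintype C] (hμ : μ ∈ stdSimplex ℝ Ω)
    (f : Ω → A) (g : Ω → B) (h : Ω → C) :
    ∑ p : A × B × C, law μ (fun ω => (f ω, h ω)) (p.1, p.2.2) * law μ (fun ω => (g ω, h ω)) p.2
      / law μ h p.2.2 = 1 := by
  have hc : ∀ c, ∑ b, ∑ a, law μ (fun ω => (f ω, h ω)) (a, c) * law μ (fun ω => (g ω, h ω)) (b, c)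
      / law μ h c = law μ h c := fun c => by
    simp only [← Finset.sum_div, ← Finset.sum_mul, ← Finset.mul_sum, sum_law_prodMk,
      mul_self_div_self]
  rw [Fintype.sum_prod_type, Finset.sum_comm, Fintype.sum_prod_type, Finset.sum_comm,
    Finset.sum_congr rfl fun c _ => hc c]
  exact (law_mem_stdSimplex hμ h).2

-- The reference law of `(f, g, h)` makes `f` and `g` conditionally independent given `h`.
lemma rvEntropy_submodular [Finite A] [Finite B] [Finite C] (hμ : μ ∈ stdSimplex ℝ Ω)
    (f : Ω → A) (g : Ω → B) (h : Ω → C) :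
    rvEntropy μ (fun ω => (f ω, g ω, h ω)) + rvEntropy μ h
      ≤ rvEntropy μ (fun ω => (f ω, h ω)) + rvEntropy μ (fun ω => (g ω, h ω)) := by
  have := Fintype.ofFinite A
  have := Fintype.ofFinite B
  have := Fintype.ofFinite C
  set fh := fun ω => (f ω, h ω)
  set gh := fun ω => (g ω, h ω)
  let q : A × B × C → ℝ := fun p => law μ fh (p.1, p.2.2) * law μ gh p.2 / law μ h p.2.2
  have hq0 : ∀ p, 0 ≤ q p := fun p =>
    div_nonneg (mul_nonneg (law_nonneg hμ.1 _ _) (law_nonneg hμ.1 _ _)) (law_nonneg hμ.1 _ _)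
  have hq1 : ∑ p, q p = 1 := sum_law_mul_law_div_law hμ f g h
  have hlaw : ∀ ω, 0 < μ ω →
      0 < law μ fh (fh ω) ∧ 0 < law μ gh (gh ω) ∧ 0 < law μ h (h ω) := fun ω hω =>
    ⟨hω.trans_le (le_law hμ.1 fh ω), hω.trans_le (le_law hμ.1 gh ω), hω.trans_le (le_law hμ.1 h ω)⟩
  have hlog : ∀ ω, μ ω * Real.logb 2 (q (f ω, g ω, h ω))
      = μ ω * Real.logb 2 (law μ fh (fh ω)) + μ ω * Real.logb 2 (law μ gh (gh ω))
        - μ ω * Real.logb 2 (law μ h (h ω)) := by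
    intro ω
    rcases (hμ.1 ω).eq_or_lt with h0 | h0
    · simp [← h0]
    · obtain ⟨hf, hg, hh⟩ := hlaw ω h0
      rw [Real.logb_div (mul_pos hf hg).ne' hh.ne', Real.logb_mul hf.ne' hg.ne']
      ring
  have key := rvEntropy_le_of_reference hμ (fun ω => (f ω, g ω, h ω)) hq0 hq1.le fun ω hω =>
    div_pos (mul_pos (hlaw ω hω).1 (hlaw ω hω).2.1) (hlaw ω hω).2.2
  simp only [hlog, Finset.sum_sub_distrib, Finset.sum_add_distrib] at key
  simp only [rvEntropy] at key ⊢
  linarith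

lemma rvEntropy_prodMk_le [Finite A] [Finite B] (hμ : μ ∈ stdSimplex ℝ Ω) (f : Ω → A) (g : Ω → B) :
    rvEntropy μ (fun ω => (f ω, g ω)) ≤ rvEntropy μ f + rvEntropy μ g := by
  have hunit : rvEntropy μ (fun _ => ()) = 0 := by simp [rvEntropy, law, hμ.2]
  have hsub := rvEntropy_submodular hμ f g fun _ => ()
  have hfg : rvEntropy μ (fun ω => (f ω, g ω)) ≤ rvEntropy μ (fun ω => (f ω, g ω, ())) :=
    rvEntropy_le_of_factorsThrough hμ.1 fun _ _ => by simp
  have hf : rvEntropy μ (fun ω => (f ω, ())) ≤ rvEntropy μ f :=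
    rvEntropy_le_of_factorsThrough hμ.1 fun _ _ => by simp
  have hg : rvEntropy μ (fun ω => (g ω, ())) ≤ rvEntropy μ g :=
    rvEntropy_le_of_factorsThrough hμ.1 fun _ _ => by simp
  linarith

lemma rvEntropy_pi_le_of_reference [Fintype ι] [Fintype A] (hμ : μ ∈ stdSimplex ℝ Ω)
    (f : Ω → ι → A) {q : ι → A → ℝ} (hq : ∀ j, q j ∈ stdSimplex ℝ A)
    (hpos : ∀ ω j, 0 < μ ω → 0 < q j (f ω j)) :
    rvEntropy μ f ≤ -∑ j, ∑ ω, μ ω * Real.logb 2 (q j (f ω j)) := by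
  classical
  refine (rvEntropy_le_of_reference hμ f (g := fun a => ∏ j, q j (a j))
    (fun a => Finset.prod_nonneg fun j _ => (hq j).1 _) ?_
    (fun ω h => Finset.prod_pos fun j _ => hpos ω j h)).trans_eq ?_
  · simp [← Fintype.prod_sum, (hq _).2]
  · rw [Finset.sum_comm]
    congr 1
    refine Finset.sum_congr rfl fun ω _ => ?_
    rcases (hμ.1 ω).eq_or_lt with h0 | h0
    · simp [← h0]
    · rw [Real.logb_prod _ _ fun j _ => (hpos ω j h0).ne', Finset.mul_sum]

lemma rvEntropy_pi_le_sum [Fintype ι] [Finite A] (hμ : μ ∈ stdSimplex ℝ Ω) (f : Ω → ι → A) :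
    rvEntropy μ f ≤ ∑ j, rvEntropy μ fun ω => f ω j := by
  have := Fintype.ofFinite A
  simpa only [rvEntropy, Finset.sum_neg_distrib] using
    rvEntropy_pi_le_of_reference hμ f (fun j => law_mem_stdSimplex hμ fun ω => f ω j)
      fun ω j h => h.trans_le (le_law hμ.1 (fun ω => f ω j) ω)

/-- The average over `j` of the laws of the coordinates `f · j` of a random vector, that is, the law
of a uniformly chosen coordinate. -/
noncomputable def averageLaw [Fintype ι] (μ : Ω → ℝ) (f : Ω → ι → A) (a : A) : ℝ :=
  (Fintype.card ι : ℝ)⁻¹ * ∑ j, law μ (fun ω => f ω j) a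

lemma sum_averageLaw_mul [Fintype ι] [Fintype A] (μ : Ω → ℝ) (f : Ω → ι → A) (F : A → ℝ) :
    ∑ a, averageLaw μ f a * F a = (Fintype.card ι : ℝ)⁻¹ * ∑ j, ∑ ω, μ ω * F (f ω j) := by
  simp only [averageLaw, mul_assoc, Finset.sum_mul, ← Finset.mul_sum]
  rw [Finset.sum_comm]
  simp only [sum_law_mul μ (fun ω => f ω _)]

lemma averageLaw_mem_stdSimplex [Fintype ι] [Nonempty ι] [Fintype A] (hμ : μ ∈ stdSimplex ℝ Ω)
    (f : Ω → ι → A) : averageLaw μ f ∈ stdSimplex ℝ A := by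
  refine ⟨fun a => mul_nonneg (by positivity)
    (Finset.sum_nonneg fun j _ => law_nonneg hμ.1 _ _), ?_⟩
  simpa [hμ.2] using sum_averageLaw_mul μ f fun _ => 1

lemma rvEntropy_pi_le_card_mul_entropy_averageLaw [Fintype ι] [Nonempty ι] [Fintype A]
    (hμ : μ ∈ stdSimplex ℝ Ω) (f : Ω → ι → A) :
    rvEntropy μ f ≤ Fintype.card ι * entropy (averageLaw μ f) := by
  refine (rvEntropy_pi_le_of_reference hμ f (fun _ => averageLaw_mem_stdSimplex hμ f)
    fun ω j h => mul_pos (by positivity) ?_).trans_eq ?_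
  · refine (h.trans_le (le_law hμ.1 (fun ω => f ω j) ω)).trans_le ?_
    exact Finset.single_le_sum (f := fun j' => law μ (fun ω => f ω j') (f ω j))
      (fun j' _ => law_nonneg hμ.1 _ _) (Finset.mem_univ j)
  · rw [entropy, sum_averageLaw_mul μ f fun a => Real.logb 2 (averageLaw μ f a)]
    field_simp

lemma rvEntropy_le_rvMutualInfo_add [Finite A] [Finite B] [Finite C] (hμ : μ ∈ stdSimplex ℝ Ω)
    {f : Ω → A} {g : Ω → B} {w : Ω → C} (hf : f.FactorsThrough fun ω => (w ω, g ω)) :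
    rvEntropy μ f ≤ rvMutualInfo μ f g + rvEntropy μ w := by
  have hfg : rvEntropy μ (fun ω => (f ω, g ω)) ≤ rvEntropy μ (fun ω => (w ω, g ω)) :=
    rvEntropy_le_of_factorsThrough hμ.1 fun _ _ h => Prod.ext (hf h) (Prod.ext_iff.1 h).2
  have hwg := rvEntropy_prodMk_le hμ w g
  rw [rvMutualInfo]
  linarith

lemma rvMutualInfo_comm (hμ : ∀ ω, 0 ≤ μ ω) (f : Ω → A) (g : Ω → B) :
    rvMutualInfo μ f g = rvMutualInfo μ g f := by
  have hswap : rvEntropy μ (fun ω => (f ω, g ω)) = rvEntropy μ (fun ω => (g ω, f ω)) :=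
    le_antisymm (rvEntropy_le_of_factorsThrough hμ fun _ _ h => by simp_all)
      (rvEntropy_le_of_factorsThrough hμ fun _ _ h => by simp_all)
  rw [rvMutualInfo, rvMutualInfo, hswap, add_comm (rvEntropy μ f)]

lemma rvMutualInfo_le_of_factorsThrough_right [Finite A] [Finite B] [Finite C]
    (hμ : μ ∈ stdSimplex ℝ Ω) (f : Ω → A) {g : Ω → B} {h : Ω → C} (hgh : g.FactorsThrough h) :
    rvMutualInfo μ f g ≤ rvMutualInfo μ f h := by
  have hsub := rvEntropy_submodular hμ f h g
  have hhg : rvEntropy μ (fun ω => (h ω, g ω)) ≤ rvEntropy μ h :=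
    rvEntropy_le_of_factorsThrough hμ.1 fun _ _ e => Prod.ext e (hgh e)
  have hfh : rvEntropy μ (fun ω => (f ω, h ω)) ≤ rvEntropy μ (fun ω => (f ω, h ω, g ω)) :=
    rvEntropy_le_of_factorsThrough hμ.1 fun _ _ e => by simp_all
  simp only [rvMutualInfo]
  linarith

lemma rvMutualInfo_le_of_factorsThrough_left [Finite A] [Finite B] [Finite C]
    (hμ : μ ∈ stdSimplex ℝ Ω) {f : Ω → A} {g : Ω → B} (hfg : f.FactorsThrough g) (h : Ω → C) :
    rvMutualInfo μ f h ≤ rvMutualInfo μ g h := by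
  rw [rvMutualInfo_comm hμ.1 f, rvMutualInfo_comm hμ.1 g]
  exact rvMutualInfo_le_of_factorsThrough_right hμ h hfg

lemma rvMutualInfo_prodMk_right_le [Finite B] [Finite C] (hμ : μ ∈ stdSimplex ℝ Ω)
    (f : Ω → A) (g : Ω → B) (h : Ω → C) :
    rvMutualInfo μ f (fun ω => (g ω, h ω)) ≤ rvEntropy μ g + rvMutualInfo μ f h := by
  have hgh := rvEntropy_prodMk_le hμ g h
  have hfh : rvEntropy μ (fun ω => (f ω, h ω)) ≤ rvEntropy μ (fun ω => (f ω, g ω, h ω)) :=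
    rvEntropy_le_of_factorsThrough hμ.1 fun _ _ e => by simp_all
  simp only [rvMutualInfo]
  linarith

end RandomVariables

section ProductLaw

variable {ι κ Y : Type*} [Fintype ι] [Fintype κ]

/-- The joint law of independent letters, the `t`-th of which has law `p t`. -/
def productLaw (p : ι → Y → ℝ) (y : ι → Y) : ℝ := ∏ t, p t (y t)

variable [Fintype Y] {p : ι → Y → ℝ}

lemma productLaw_mem_stdSimplex [DecidableEq ι] (hp : ∀ t, p t ∈ stdSimplex ℝ Y) :
    productLaw p ∈ stdSimplex ℝ (ι → Y) :=
  ⟨fun _ => Finset.prod_nonneg fun t _ => (hp t).1 _, by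
    simp [productLaw, ← Fintype.prod_sum, (hp _).2]⟩

lemma law_productLaw_comp [DecidableEq ι] (hp : ∀ t, p t ∈ stdSimplex ℝ Y) {e : κ → ι}
    (he : e.Injective) :
    law (productLaw p) (fun y j => y (e j)) = productLaw fun j => p (e j) := by
  classical
  ext b
  have hcyl : (Finset.univ.filter fun y : ι → Y => (fun j => y (e j)) = b)
      = Fintype.piFinset fun t => Finset.univ.filter fun c => ∀ j, e j = t → c = b j := by
    ext y
    simp only [Finset.mem_filter_univ, Fintype.mem_piFinset, funext_iff]
    exact ⟨fun h t j hj => hj ▸ h j, fun h j => h _ j rfl⟩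
  simp only [law, productLaw, hcyl, ← Finset.prod_univ_sum]
  refine (Fintype.prod_of_injective e he _ _ (fun t ht => ?_) fun j => ?_).symm
  · rw [Finset.filter_true_of_mem fun c _ j hj => absurd ⟨j, hj⟩ ht, (hp t).2]
  · simp [he.eq_iff, Finset.sum_filter]

lemma law_productLaw_eval [DecidableEq ι] (hp : ∀ t, p t ∈ stdSimplex ℝ Y) (t : ι) :
    law (productLaw p) (fun y => y t) = p t := by
  ext c
  have h := congrFun (law_productLaw_comp hp (Function.injective_of_subsingleton fun _ : Unit => t))
    (Function.const Unit c)
  rw [← law_comp_of_injective (productLaw p) (fun y => y t) (Function.const_injective (α := Unit))]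
  exact h.trans (Fintype.prod_unique _)

lemma entropy_productLaw [DecidableEq ι] (hp : ∀ t, p t ∈ stdSimplex ℝ Y) :
    entropy (productLaw p) = ∑ t, entropy (p t) := by
  have hterm : ∀ y, productLaw p y * Real.logb 2 (productLaw p y)
      = ∑ t, productLaw p y * Real.logb 2 (p t (y t)) := by
    intro y
    by_cases h : productLaw p y = 0
    · simp [h]
    · rw [← Finset.mul_sum, productLaw, Real.logb_prod _ _ (Finset.prod_ne_zero_iff.1 h)]
  simp only [entropy, hterm, Finset.sum_neg_distrib]
  rw [Finset.sum_comm]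
  refine congrArg Neg.neg (Finset.sum_congr rfl fun t _ => ?_)
  rw [← sum_law_mul _ (fun y : ι → Y => y t) fun c => Real.logb 2 (p t c), law_productLaw_eval hp]

end ProductLaw

section Blocks

variable {k ℓ : ℕ} {A : Type*}

/-- The `i`-th block of length `ℓ` of a word of length `k * ℓ`. -/
def block (w : Fin (k * ℓ) → A) (i : Fin k) (j : Fin ℓ) : A :=
  w (finProdFinEquiv (i, j))

lemma block_injective_index (i : Fin k) :
    Function.Injective fun j : Fin ℓ => finProdFinEquiv (i, j) := fun _ _ h =>
  (Prod.ext_iff.1 (finProdFinEquiv.injective h)).2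

lemma sum_block {M : Type*} [AddCommMonoid M] (F : Fin (k * ℓ) → M) :
    ∑ t, F t = ∑ i, ∑ j, block F i j := by
  rw [← finProdFinEquiv.sum_comp, Fintype.sum_prod_type]
  rfl

/-- The entropy of the empirical distribution of the `k` consecutive blocks of length `ℓ`, that is,
of the block with a uniformly distributed index. -/
noncomputable def blockEntropy (u : Fin (k * ℓ) → A) : ℝ :=
  rvEntropy (fun _ : Fin k => (k : ℝ)⁻¹) (block u)

lemma uniform_mem_stdSimplex (hk : 0 < k) :
    (fun _ : Fin k => (k : ℝ)⁻¹) ∈ stdSimplex ℝ (Fin k) :=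
  ⟨fun _ => by positivity, by simp [hk.ne']⟩

/-- The joint law of a uniformly distributed block index and of independent letters with laws
`p t`. -/
noncomputable def blockLaw {Y : Type*} (p : Fin (k * ℓ) → Y → ℝ)
    (ω : Fin k × (Fin (k * ℓ) → Y)) : ℝ :=
  (k : ℝ)⁻¹ * productLaw p ω.2

variable {Y : Type*} [Fintype Y] {p : Fin (k * ℓ) → Y → ℝ}

lemma sum_blockLaw_mul (F : Fin k → (Fin (k * ℓ) → Y) → ℝ) :
    ∑ ω, blockLaw p ω * F ω.1 ω.2 = (k : ℝ)⁻¹ * ∑ i, ∑ y, productLaw p y * F i y := by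
  simp only [Fintype.sum_prod_type, blockLaw, mul_assoc, Finset.mul_sum]

lemma blockLaw_mem_stdSimplex (hk : 0 < k) (hp : ∀ t, p t ∈ stdSimplex ℝ Y) :
    blockLaw p ∈ stdSimplex ℝ (Fin k × (Fin (k * ℓ) → Y)) := by
  have h := productLaw_mem_stdSimplex hp
  refine ⟨fun ω => mul_nonneg (by positivity) (h.1 ω.2), ?_⟩
  simpa [h.2, hk.ne'] using sum_blockLaw_mul (p := p) fun _ _ => 1

lemma law_blockLaw_fst (hp : ∀ t, p t ∈ stdSimplex ℝ Y) :
    law (blockLaw p) Prod.fst = fun _ : Fin k => (k : ℝ)⁻¹ := by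
  classical
  ext i
  refine (law_compProd (fun _ => (k : ℝ)⁻¹) (fun _ => productLaw p) Prod.fst i).trans ?_
  rw [Fintype.sum_eq_single i fun i' h => by simp [law, h]]
  simp [law, (productLaw_mem_stdSimplex hp).2]

lemma law_blockLaw_block (hp : ∀ t, p t ∈ stdSimplex ℝ Y) :
    law (blockLaw p) (fun ω => (ω.1, block ω.2 ω.1))
      = fun c => (k : ℝ)⁻¹ * productLaw (block p c.1) c.2 := by
  classical
  ext ⟨i, b⟩
  refine (law_compProd (fun _ => (k : ℝ)⁻¹) (fun _ => productLaw p) _ (i, b)).trans ?_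
  rw [Fintype.sum_eq_single i fun i' h => by simp [law, h]]
  have h : law (productLaw p) (fun y => block y i) b = productLaw (block p i) b :=
    congrFun (law_productLaw_comp hp (block_injective_index i)) b
  simp only [← h, law, Prod.mk.injEq, true_and]

lemma law_blockLaw_letter (hp : ∀ t, p t ∈ stdSimplex ℝ Y) (j : Fin ℓ) (c : Y) :
    law (blockLaw p) (fun ω => block ω.2 ω.1 j) c = ∑ i, (k : ℝ)⁻¹ * block p i j c := by
  refine (law_compProd (fun _ => (k : ℝ)⁻¹) (fun _ => productLaw p) _ c).trans ?_
  exact Finset.sum_congr rfl fun i _ =>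
    congrArg _ (congrFun (law_productLaw_eval hp (finProdFinEquiv (i, j))) c)

lemma rvEntropy_blockLaw_index_block (hp : ∀ t, p t ∈ stdSimplex ℝ Y) :
    rvEntropy (blockLaw p) (fun ω => (ω.1, block ω.2 ω.1))
      = rvEntropy (blockLaw p) Prod.fst + (k : ℝ)⁻¹ * ∑ t, entropy (p t) := by
  have hblock : ∀ i, ∀ j, block p i j ∈ stdSimplex ℝ Y := fun i j => hp _
  rw [← entropy_law, ← entropy_law, law_blockLaw_block hp, law_blockLaw_fst hp,
    entropy_chain_rule (fun _ => (k : ℝ)⁻¹) fun i => (productLaw_mem_stdSimplex (hblock i)).2,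
    sum_block, ← Finset.mul_sum]
  simp only [entropy_productLaw (hblock _)]
  rfl

lemma rvEntropy_blockLaw_comp_fst (hp : ∀ t, p t ∈ stdSimplex ℝ Y) (u : Fin (k * ℓ) → A) :
    rvEntropy (blockLaw p) (fun ω => block u ω.1) = blockEntropy u := by
  rw [rvEntropy_comp _ Prod.fst (block u), law_blockLaw_fst hp, blockEntropy]

end Blocks

section Capacity

variable {X Y : Type*} [Fintype X] [Fintype Y] {P : X → Y → ℝ}

lemma output_mem_stdSimplex (hP : IsChannel P) {p : X → ℝ} (hp : p ∈ stdSimplex ℝ X) :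
    (fun y => ∑ x, p x * P x y) ∈ stdSimplex ℝ Y := by
  refine ⟨fun y => Finset.sum_nonneg fun x _ => mul_nonneg (hp.1 x) ((hP x).1 y), ?_⟩
  rw [Finset.sum_comm]
  simp [← Finset.mul_sum, (hP _).2, hp.2]

lemma mutualInfo_le_capacity (hP : IsChannel P) {p : X → ℝ} (hp : p ∈ stdSimplex ℝ X) :
    mutualInfo p P ≤ capacity P := by
  refine le_csSup ⟨Real.logb 2 (Fintype.card Y), ?_⟩ ⟨p, hp, rfl⟩
  rintro _ ⟨q, hq, rfl⟩
  have hcond : 0 ≤ ∑ x, q x * entropy (P x) :=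
    Finset.sum_nonneg fun x _ => mul_nonneg (hq.1 x) (entropy_nonneg (hP x))
  exact (sub_le_self _ hcond).trans (entropy_le_logb_card (output_mem_stdSimplex hP hq))

variable {k ℓ : ℕ}

lemma rvEntropy_letter_le (hk : 0 < k) (hP : IsChannel P) (x : Fin (k * ℓ) → X) (j : Fin ℓ) :
    rvEntropy (blockLaw fun t => P (x t)) (fun ω => block ω.2 ω.1 j)
      ≤ capacity P + (k : ℝ)⁻¹ * ∑ i, entropy (P (block x i j)) := by
  let p : X → ℝ := law (fun _ : Fin k => (k : ℝ)⁻¹) fun i => block x i j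
  have hcap : mutualInfo p P ≤ capacity P :=
    mutualInfo_le_capacity hP (law_mem_stdSimplex (uniform_mem_stdSimplex hk) _)
  have hout : law (blockLaw fun t => P (x t)) (fun ω => block ω.2 ω.1 j)
      = fun y => ∑ a, p a * P a y := by
    ext y
    rw [law_blockLaw_letter fun t => hP (x t), sum_law_mul _ _ fun a => P a y]
    rfl
  rw [mutualInfo, ← hout, entropy_law, sum_law_mul _ _ fun a => entropy (P a),
    ← Finset.mul_sum] at hcap
  linarith

lemma rvMutualInfo_index_block_le (hk : 0 < k) (hP : IsChannel P) (x : Fin (k * ℓ) → X) :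
    rvMutualInfo (blockLaw fun t => P (x t)) Prod.fst (fun ω => block ω.2 ω.1)
      ≤ ℓ * capacity P := by
  have hp : ∀ t, P (x t) ∈ stdSimplex ℝ Y := fun t => hP _
  have hletters : rvEntropy (blockLaw fun t => P (x t)) (fun ω => block ω.2 ω.1)
      ≤ ℓ * capacity P + (k : ℝ)⁻¹ * ∑ t, entropy (P (x t)) :=
    calc _ ≤ ∑ j, rvEntropy (blockLaw fun t => P (x t)) (fun ω => block ω.2 ω.1 j) :=
          rvEntropy_pi_le_sum (blockLaw_mem_stdSimplex hk hp) _
      _ ≤ ∑ j, (capacity P + (k : ℝ)⁻¹ * ∑ i, entropy (P (block x i j))) :=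
          Finset.sum_le_sum fun j _ => rvEntropy_letter_le hk hP x j
      _ = _ := by
          rw [Finset.sum_add_distrib, ← Finset.mul_sum, Finset.sum_comm, sum_block]
          simp [block]
  rw [rvMutualInfo, rvEntropy_blockLaw_index_block hp]
  linarith

end Capacity

section DecoderBlocks

variable {k ℓ : ℕ} {Z Y V : Type*}

lemma block_mk (w : Fin (k * ℓ) → V) (i : Fin k) {m : ℕ} (hm : m < ℓ) :
    ∃ h : ℓ * i + m < k * ℓ, block w i ⟨m, hm⟩ = w ⟨ℓ * i + m, h⟩ := by
  have hval : ((finProdFinEquiv (i, (⟨m, hm⟩ : Fin ℓ)) : Fin (k * ℓ)) : ℕ) = ℓ * i + m := by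
    rw [finProdFinEquiv_apply_val, add_comm]
  exact ⟨hval ▸ Fin.isLt _, congrArg w (Fin.ext hval)⟩

lemma Decoder.state_eq_of_block_eq (D : Decoder Z Y V) {y y' : Fin (k * ℓ) → Y} {i i' : Fin k}
    (hz : D.state ℓ y (ℓ * i) = D.state ℓ y' (ℓ * i')) (hb : block y i = block y' i') :
    ∀ m ≤ ℓ, D.state ℓ y (ℓ * i + m) = D.state ℓ y' (ℓ * i' + m) := by
  intro m hm
  induction m with
  | zero => exact hz
  | succ m ih =>
    obtain ⟨h, hy⟩ := block_mk y i hm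
    obtain ⟨h', hy'⟩ := block_mk y' i' hm
    have hcounter : ∀ a : ℕ, (ℓ * a + m + 1) % ℓ = (m + 1) % ℓ := fun a => by
      rw [add_assoc, Nat.mul_add_mod]
    rw [← Nat.add_assoc, ← Nat.add_assoc, Decoder.state, Decoder.state, dif_pos h, dif_pos h',
      hcounter, hcounter, ih (Nat.le_of_succ_le hm), ← hy, ← hy', hb]

lemma Decoder.recon_eq_of_block_eq (D : Decoder Z Y V) {d : ℕ}
    (tail : (Fin (k * ℓ) → Y) → Fin (k * ℓ) → V) {y y' : Fin (k * ℓ) → Y} {i i' : Fin k}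
    (hz : D.state ℓ y (ℓ * i) = D.state ℓ y' (ℓ * i')) (hb : block y i = block y' i')
    (j : Fin ℓ) (hj : j + d < ℓ) :
    block (D.recon ℓ d tail y) i j = block (D.recon ℓ d tail y') i' j := by
  obtain ⟨h, hy⟩ := block_mk y i hj
  obtain ⟨h', hy'⟩ := block_mk y' i' hj
  obtain ⟨_, hv⟩ := block_mk (D.recon ℓ d tail y) i j.2
  obtain ⟨_, hv'⟩ := block_mk (D.recon ℓ d tail y') i' j.2
  have hcounter : ∀ a : ℕ, (ℓ * a + (j + d) + 1) % ℓ = (j + d + 1) % ℓ := fun a => by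
    rw [add_assoc, Nat.mul_add_mod]
  refine hv.trans (Eq.trans ?_ hv'.symm)
  simp only [Decoder.recon, Nat.add_assoc (ℓ * _) (j : ℕ) d, dif_pos h, dif_pos h', hcounter,
    D.state_eq_of_block_eq hz hb (j + d) hj.le, ← hy, ← hy', hb]

lemma Decoder.factorsThrough_state_undecoded_output (D : Decoder Z Y V) (d : ℕ)
    (tail : (Fin (k * ℓ) → Y) → Fin (k * ℓ) → V) :
    Function.FactorsThrough (fun ω : Fin k × (Fin (k * ℓ) → Y) => block (D.recon ℓ d tail ω.2) ω.1)
      fun ω => (D.state ℓ ω.2 (ℓ * ω.1),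
        fun j : {j : Fin ℓ // ℓ ≤ j + d} => block (D.recon ℓ d tail ω.2) ω.1 j,
        block ω.2 ω.1) := by
  intro ω ω' h
  obtain ⟨hstate, hlast, hout⟩ : _ ∧ _ ∧ _ := by simpa only [Prod.mk.injEq] using h
  ext j
  by_cases hj : (j : ℕ) + d < ℓ
  · exact D.recon_eq_of_block_eq tail hstate hout j hj
  · exact congrFun hlast ⟨j, not_lt.1 hj⟩

lemma logb_card_undecoded_le [Fintype V] (d : ℕ) :
    Real.logb 2 (Fintype.card ({j : Fin ℓ // ℓ ≤ j + d} → V))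
      ≤ d * Real.logb 2 (Fintype.card V) := by
  have hcard : Fintype.card {j : Fin ℓ // ℓ ≤ j + d} ≤ d := by
    let e : {j : Fin ℓ // ℓ ≤ j + d} → Fin d := fun j => ⟨j.1 + d - ℓ, by omega⟩
    have he : e.Injective := fun a b h => by
      have := Fin.mk.inj_iff.1 h
      exact Subtype.ext (Fin.ext (by omega))
    simpa using Fintype.card_le_of_injective e he
  rw [Fintype.card_fun, Nat.cast_pow, Real.logb_pow]
  gcongr
  exact logb_two_natCast_nonneg _

end DecoderBlocks

section Converse

variable {k ℓ : ℕ} {U V X Y Z : Type*} [Fintype X] [Fintype Y] [Fintype Z] {P : X → Y → ℝ}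

lemma rvMutualInfo_index_recon_le [Fintype V] (hk : 0 < k) (hP : IsChannel P)
    (x : Fin (k * ℓ) → X) (d : ℕ) (D : Decoder Z Y V)
    (tail : (Fin (k * ℓ) → Y) → Fin (k * ℓ) → V) :
    rvMutualInfo (blockLaw fun t => P (x t)) Prod.fst (fun ω => block (D.recon ℓ d tail ω.2) ω.1)
      ≤ Real.logb 2 (Fintype.card Z) + (d * Real.logb 2 (Fintype.card V) + ℓ * capacity P) := by
  classical
  have hμ := blockLaw_mem_stdSimplex (ℓ := ℓ) hk fun t => hP (x t)
  set μ := blockLaw fun t => P (x t)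
  let state := fun ω : Fin k × (Fin (k * ℓ) → Y) => D.state ℓ ω.2 (ℓ * ω.1)
  let last := fun (ω : Fin k × (Fin (k * ℓ) → Y)) (j : {j : Fin ℓ // ℓ ≤ j + d}) =>
    block (D.recon ℓ d tail ω.2) ω.1 j
  let output := fun ω : Fin k × (Fin (k * ℓ) → Y) => block ω.2 ω.1
  calc _ ≤ rvMutualInfo μ Prod.fst fun ω => (state ω, last ω, output ω) :=
        rvMutualInfo_le_of_factorsThrough_right hμ _
          (D.factorsThrough_state_undecoded_output d tail)
    _ ≤ rvEntropy μ state + rvMutualInfo μ Prod.fst fun ω => (last ω, output ω) :=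
        rvMutualInfo_prodMk_right_le hμ _ _ _
    _ ≤ rvEntropy μ state + (rvEntropy μ last + rvMutualInfo μ Prod.fst output) := by
        gcongr
        exact rvMutualInfo_prodMk_right_le hμ _ _ _
    _ ≤ _ := by
        gcongr
        · exact rvEntropy_le_logb_card hμ state
        · exact (rvEntropy_le_logb_card hμ last).trans (logb_card_undecoded_le d)
        · exact rvMutualInfo_index_block_le hk hP x

variable [AddGroup U] [Fintype U]

lemma exists_error_law (hk : 0 < k) (hℓ : 0 < ℓ) (hP : IsChannel P) (u : Fin (k * ℓ) → U)
    (x : Fin (k * ℓ) → X) (d : ℕ) (D : Decoder Z Y U)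
    (tail : (Fin (k * ℓ) → Y) → Fin (k * ℓ) → U) (ϱ : U → ℝ) :
    ∃ q ∈ stdSimplex ℝ U,
      ∑ w, q w * ϱ w = (1 / ((k * ℓ : ℕ) : ℝ)) * ∑ t, expect P x
        (fun y => ϱ (D.recon ℓ d tail y t - u t)) ∧
      blockEntropy u ≤ ℓ * (entropy q + capacity P)
        + Real.logb 2 (Fintype.card Z) + d * Real.logb 2 (Fintype.card U) := by
  classical
  have : Nonempty (Fin ℓ) := ⟨⟨0, hℓ⟩⟩
  have hp : ∀ t, P (x t) ∈ stdSimplex ℝ Y := fun t => hP _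
  have hμ := blockLaw_mem_stdSimplex (ℓ := ℓ) hk hp
  set μ := blockLaw fun t => P (x t)
  let source := fun ω : Fin k × (Fin (k * ℓ) → Y) => block u ω.1
  let recon := fun ω : Fin k × (Fin (k * ℓ) → Y) => block (D.recon ℓ d tail ω.2) ω.1
  let error := fun (ω : Fin k × (Fin (k * ℓ) → Y)) j => recon ω j - source ω j
  refine ⟨averageLaw μ error, averageLaw_mem_stdSimplex hμ error, ?_, ?_⟩
  · have hblock : ∀ j, ∑ ω, μ ω * ϱ (error ω j) = (k : ℝ)⁻¹ * ∑ i, ∑ y,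
        productLaw (fun t => P (x t)) y * ϱ (block (D.recon ℓ d tail y) i j - block u i j) :=
      fun j => sum_blockLaw_mul fun i y => ϱ (block (D.recon ℓ d tail y) i j - block u i j)
    rw [sum_averageLaw_mul, sum_block, Finset.sum_comm (s := (Finset.univ : Finset (Fin k))),
      Fintype.card_fin, Nat.cast_mul, one_div,
      mul_inv_rev, mul_assoc, Finset.mul_sum (a := (k : ℝ)⁻¹)]
    exact congrArg _ (Finset.sum_congr rfl fun j _ => hblock j)
  · have hsource : source.FactorsThrough fun ω => (error ω, recon ω) := fun ω ω' h => by
      obtain ⟨herror, hrecon⟩ := Prod.mk.injEq _ _ _ _ ▸ h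
      ext j
      have hj : recon ω j - source ω j = recon ω' j - source ω' j := congrFun herror j
      rwa [hrecon, sub_right_inj] at hj
    have hindex : source.FactorsThrough Prod.fst := fun _ _ h => congrArg (block u) h
    calc blockEntropy u = rvEntropy μ source := (rvEntropy_blockLaw_comp_fst hp u).symm
      _ ≤ rvMutualInfo μ source recon + rvEntropy μ error :=
          rvEntropy_le_rvMutualInfo_add hμ hsource
      _ ≤ rvMutualInfo μ Prod.fst recon + ℓ * entropy (averageLaw μ error) := by
          refine add_le_add (rvMutualInfo_le_of_factorsThrough_left hμ hindex recon) ?_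
          simpa using rvEntropy_pi_le_card_mul_entropy_averageLaw hμ error
      _ ≤ _ := by linarith [rvMutualInfo_index_recon_le hk hP x d D tail]

end Converse

section Parsing

variable {A : Type*}

lemma length_le_length_flatten {L : List (List A)} (hL : ∀ p ∈ L, p ≠ []) :
    L.length ≤ L.flatten.length := by
  rw [List.length_flatten, ← List.length_map List.length]
  exact List.length_le_sum_of_one_le _ (by simpa [Nat.one_le_iff_ne_zero] using hL)

variable [DecidableEq A]

lemma lzParseAux_spec (rest : List A) (done : List (List A)) (cur : List A) (hdone : done.Nodup) :
    ∃ new last, lzParseAux done cur rest = done ++ new ++ last ∧ (done ++ new).Nodup ∧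
      last.length ≤ 1 ∧ (new ++ last).flatten = cur ++ rest ∧ ∀ p ∈ new ++ last, p ≠ [] := by
  induction rest generalizing done cur with
  | nil =>
    by_cases hcur : cur = []
    · exact ⟨[], [], by simp [lzParseAux, hcur, hdone]⟩
    · exact ⟨[], [cur], by simp [lzParseAux, hcur, hdone]⟩
  | cons a rest ih =>
    by_cases hmem : cur ++ [a] ∈ done
    · obtain ⟨new, last, hparse, hnodup, hlast, hflat, hne⟩ := ih done (cur ++ [a]) hdone
      refine ⟨new, last, ?_, hnodup, hlast, ?_, hne⟩
      · rw [lzParseAux, if_pos hmem, hparse]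
      · rw [hflat, List.append_assoc, List.singleton_append]
    · have hdone' : (done ++ [cur ++ [a]]).Nodup := by
        rw [List.nodup_append_comm]
        exact List.nodup_cons.2 ⟨hmem, hdone⟩
      obtain ⟨new, last, hparse, hnodup, hlast, hflat, hne⟩ := ih (done ++ [cur ++ [a]]) [] hdone'
      refine ⟨(cur ++ [a]) :: new, last, ?_, ?_, hlast, ?_, ?_⟩
      · rw [lzParseAux, if_neg hmem, hparse, List.append_assoc done, List.singleton_append]
      · rwa [List.append_assoc, List.singleton_append] at hnodup
      · rw [List.cons_append, List.flatten_cons, hflat, List.nil_append, List.append_assoc,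
          List.singleton_append]
      · rw [List.cons_append]
        exact List.forall_mem_cons.2 ⟨by simp, hne⟩

lemma lzParse_spec (w : List A) : ∃ new last, lzParse w = new ++ last ∧ new.Nodup ∧
    last.length ≤ 1 ∧ (new ++ last).flatten = w ∧ ∀ p ∈ new ++ last, p ≠ [] := by
  simpa [lzParse] using lzParseAux_spec w [] [] List.nodup_nil

lemma lzCount_le {n : ℕ} (u : Fin n → A) : lzCount u ≤ n := by
  obtain ⟨new, last, hparse, -, -, hflat, hne⟩ := lzParse_spec (List.ofFn u)
  calc lzCount u = (new ++ last).length := by rw [lzCount, hparse]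
    _ ≤ (new ++ last).flatten.length := length_le_length_flatten hne
    _ = n := by rw [hflat, List.length_ofFn]

end Parsing

section WeightedAutomaton

variable {S A : Type*} (next : S → A → S) (g : S → A → ℝ)

/-- The weight of a word read from the state `s` by the automaton with transition function `next`
and transition weights `g`. If the weights leaving each state sum to one, this is the probability
of the word under the corresponding finite-state source. -/
def weight : S → List A → ℝ
  | _, [] => 1
  | s, a :: w => g s a * weight (next s a) w

/-- The weights of the consecutive phrases read by a weighted automaton from the state `s`. -/
def phraseWeights : S → List (List A) → List ℝ
  | _, [] => []
  | s, p :: L => weight next g s p :: phraseWeights (p.foldl next s) L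

lemma weight_append (s : S) (v w : List A) :
    weight next g s (v ++ w) = weight next g s v * weight next g (v.foldl next s) w := by
  induction v generalizing s with
  | nil => simp [weight]
  | cons a v ih => simp [weight, ih, mul_assoc]

lemma weight_const (β : ℝ) (s : S) (w : List A) :
    weight next (fun _ _ => β) s w = β ^ w.length := by
  induction w generalizing s with
  | nil => simp [weight]
  | cons a w ih => rw [weight, ih, List.length_cons, pow_succ']

lemma weight_const_mul (β : ℝ) (s : S) (w : List A) :
    weight next (fun s a => β * g s a) s w = β ^ w.length * weight next g s w := by
  induction w generalizing s with
  | nil => simp [weight]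
  | cons a w ih =>
    rw [weight, ih, weight, List.length_cons]
    ring

lemma prod_phraseWeights (s : S) (L : List (List A)) :
    (phraseWeights next g s L).prod = weight next g s L.flatten := by
  induction L generalizing s with
  | nil => simp [phraseWeights, weight]
  | cons p L ih => simp [phraseWeights, weight_append, ih]

lemma length_phraseWeights (s : S) (L : List (List A)) :
    (phraseWeights next g s L).length = L.length := by
  induction L generalizing s with
  | nil => rfl
  | cons p L ih => simp [phraseWeights, ih]

lemma phraseWeights_append (s : S) (L L' : List (List A)) :
    phraseWeights next g s (L ++ L')
      = phraseWeights next g s L ++ phraseWeights next g (L.flatten.foldl next s) L' := by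
  induction L generalizing s with
  | nil => rfl
  | cons p L ih => simp [phraseWeights, ih]

variable {next g}

lemma weight_nonneg (hg : ∀ s a, 0 ≤ g s a) (s : S) (w : List A) : 0 ≤ weight next g s w := by
  induction w generalizing s with
  | nil => exact zero_le_one
  | cons a w ih => exact mul_nonneg (hg s a) (ih _)

lemma phraseWeights_nonneg (hg : ∀ s a, 0 ≤ g s a) (s : S) (L : List (List A)) :
    ∀ r ∈ phraseWeights next g s L, 0 ≤ r := by
  induction L generalizing s with
  | nil => simp [phraseWeights]
  | cons p L ih => exact List.forall_mem_cons.2 ⟨weight_nonneg hg s p, ih _⟩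

lemma sum_phraseWeights_le_sum [Fintype S] (hg : ∀ s a, 0 ≤ g s a) (s : S) (L : List (List A)) :
    (phraseWeights next g s L).sum ≤ (L.map fun p => ∑ s', weight next g s' p).sum := by
  induction L generalizing s with
  | nil => simp [phraseWeights]
  | cons p L ih =>
    rw [phraseWeights, List.sum_cons, List.map_cons, List.sum_cons]
    exact add_le_add (Finset.single_le_sum (f := fun s' => weight next g s' p)
      (fun s' _ => weight_nonneg hg s' p) (Finset.mem_univ s)) (ih _)

variable [Fintype A]

lemma weight_le_one (hg : ∀ s a, 0 ≤ g s a) (hsum : ∀ s, ∑ a, g s a ≤ 1) (s : S) (w : List A) :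
    weight next g s w ≤ 1 := by
  have hle : ∀ s a, g s a ≤ 1 := fun s a =>
    (Finset.single_le_sum (fun a _ => hg s a) (Finset.mem_univ a)).trans (hsum s)
  induction w generalizing s with
  | nil => exact le_rfl
  | cons a w ih => exact mul_le_one₀ (hle s a) (weight_nonneg hg _ _) (ih _)

end WeightedAutomaton

section Kraft

variable {S A : Type*} [Fintype A] {next : S → A → S} {g : S → A → ℝ} {β : ℝ}

variable (A) in
open scoped Classical in
/-- The words of length at most `m`, arranged as a tree by their first letter. -/
noncomputable def words : ℕ → Finset (List A)
  | 0 => {[]}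
  | m + 1 => insert [] ((Finset.univ ×ˢ words m).image fun p => p.1 :: p.2)

lemma mem_words {m : ℕ} {w : List A} (hw : w.length ≤ m) : w ∈ words A m := by
  induction m generalizing w with
  | zero => simpa [words] using hw
  | succ m ih =>
    cases w with
    | nil => simp [words]
    | cons a w =>
      simp only [words, Finset.mem_insert, Finset.mem_image, Finset.mem_product, Finset.mem_univ,
        true_and, Prod.exists]
      exact Or.inr ⟨a, w, ih (by simpa using hw), rfl⟩

lemma sum_weight_words_le (hg : ∀ s a, 0 ≤ g s a) (hsum : ∀ s, ∑ a, g s a ≤ β) (hβ : β < 1)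
    (m : ℕ) (s : S) : ∑ w ∈ words A m, weight next g s w ≤ (1 - β)⁻¹ := by
  have hβ0 : 0 ≤ β := (Finset.sum_nonneg fun a _ => hg s a).trans (hsum s)
  have hβ1 : 0 < 1 - β := sub_pos.2 hβ
  induction m generalizing s with
  | zero => simpa [words, weight] using (one_le_inv₀ hβ1).2 (sub_le_self 1 hβ0)
  | succ m ih =>
    classical
    rw [words, Finset.sum_insert (by simp), Finset.sum_image (by simp +contextual [Set.InjOn]),
      Finset.sum_product]
    simp only [weight, ← Finset.mul_sum]
    calc 1 + ∑ a, g s a * ∑ w ∈ words A m, weight next g (next s a) w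
        ≤ 1 + ∑ a, g s a * (1 - β)⁻¹ := by
          gcongr with a
          · exact hg s a
          · exact ih _
      _ ≤ 1 + β * (1 - β)⁻¹ := by
          rw [← Finset.sum_mul]
          gcongr
          exact hsum s
      _ = (1 - β)⁻¹ := by
          field_simp
          ring

lemma sum_weight_le (hg : ∀ s a, 0 ≤ g s a) (hsum : ∀ s, ∑ a, g s a ≤ β) (hβ : β < 1)
    (T : Finset (List A)) (s : S) : ∑ w ∈ T, weight next g s w ≤ (1 - β)⁻¹ :=
  (Finset.sum_le_sum_of_subset_of_nonneg
    (fun _ hw => mem_words (Finset.le_sup (f := List.length) hw))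
    fun w _ _ => weight_nonneg hg s w).trans
    (sum_weight_words_le hg hsum hβ (T.sup List.length) s)

-- The state in which a phrase starts is unknown, so distinct phrases are charged to all states.
lemma sum_phraseWeights_le [Fintype S] (hg : ∀ s a, 0 ≤ g s a) (hsum : ∀ s, ∑ a, g s a ≤ β)
    (hβ : β < 1) {new last : List (List A)} (hnew : new.Nodup) (hlast : last.length ≤ 1) (s : S) :
    (phraseWeights next g s (new ++ last)).sum ≤ Fintype.card S / (1 - β) + 1 := by
  classical
  rw [phraseWeights_append, List.sum_append]
  refine add_le_add ((sum_phraseWeights_le_sum hg s new).trans ?_) ?_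
  · rw [← List.sum_toFinset _ hnew, Finset.sum_comm, div_eq_mul_inv, ← nsmul_eq_mul]
    exact Finset.sum_le_card_nsmul _ _ _ fun s' _ => sum_weight_le hg hsum hβ _ s'
  · match last, hlast with
    | [], _ => simp [phraseWeights]
    | [p], _ =>
      simpa [phraseWeights] using weight_le_one hg (fun s => (hsum s).trans hβ.le) _ p

end Kraft

section ZivInequality

lemma log_prod_le {l : List ℝ} (hl : ∀ r ∈ l, 0 < r) {α : ℝ} (hα : 0 < α) :
    Real.log l.prod ≤ α * l.sum - l.length * (1 + Real.log α) := by
  induction l with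
  | nil => simp
  | cons r l ih =>
    obtain ⟨hr, hl⟩ := List.forall_mem_cons.1 hl
    have htangent := Real.log_le_sub_one_of_pos (mul_pos hα hr)
    rw [Real.log_mul hα.ne' hr.ne'] at htangent
    rw [List.prod_cons, List.sum_cons, List.length_cons,
      Real.log_mul hr.ne' (List.prod_pos hl).ne']
    push_cast
    linarith [ih hl]

lemma length_mul_logb_length_le {l : List ℝ} (hl : ∀ r ∈ l, 0 < r) {B : ℝ} (hB : 0 < B)
    (hsum : l.sum ≤ B) :
    l.length * Real.logb 2 l.length ≤ -Real.logb 2 l.prod + l.length * Real.logb 2 B := by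
  rcases l.length.eq_zero_or_pos with hlen | hlen
  · simp [List.length_eq_zero_iff.1 hlen]
  have hc : (0 : ℝ) < l.length := by exact_mod_cast hlen
  have hlog := log_prod_le hl (div_pos hc hB)
  rw [Real.log_div hc.ne' hB.ne'] at hlog
  have hmean : (l.length : ℝ) / B * l.sum ≤ l.length := by
    rw [div_mul_eq_mul_div, div_le_iff₀ hB]
    gcongr
  simp only [Real.logb, mul_div_assoc', ← neg_div, ← add_div]
  gcongr
  linarith

variable {S A : Type*} [Fintype S] [Fintype A] [DecidableEq A] {next : S → A → S} {g : S → A → ℝ}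
  {n : ℕ} {u : Fin n → A} {s : S}

lemma lzCount_mul_logb_le_of_sum_le {β : ℝ} (hg : ∀ s a, 0 ≤ g s a) (hsum : ∀ s, ∑ a, g s a ≤ β)
    (hβ : β < 1) (hu : 0 < weight next g s (List.ofFn u)) :
    lzCount u * Real.logb 2 (lzCount u) ≤ -Real.logb 2 (weight next g s (List.ofFn u))
      + lzCount u * Real.logb 2 (Fintype.card S / (1 - β) + 1) := by
  obtain ⟨new, last, hparse, hnew, hlast, hflat, -⟩ := lzParse_spec (List.ofFn u)
  rw [← hflat, ← prod_phraseWeights] at hu ⊢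
  have hpos : ∀ r ∈ phraseWeights next g s (new ++ last), 0 < r := fun r hr =>
    (phraseWeights_nonneg hg s _ r hr).lt_of_ne' fun h => hu.ne' (List.prod_eq_zero (h ▸ hr))
  have hbound : 0 < Fintype.card S / (1 - β) + 1 :=
    add_pos_of_nonneg_of_pos (div_nonneg (Nat.cast_nonneg _) (sub_pos.2 hβ).le) one_pos
  have h := length_mul_logb_length_le hpos hbound
    (sum_phraseWeights_le hg hsum hβ hnew hlast s)
  rwa [length_phraseWeights, show (new ++ last).length = lzCount u by rw [lzCount, hparse]] at h

lemma neg_one_le_mul_logb_one_sub {ℓ : ℕ} (hℓ : 0 < ℓ) :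
    -1 ≤ ℓ * Real.logb 2 (1 - 1 / (2 * ℓ)) := by
  have hℓ' : (1 : ℝ) ≤ ℓ := by exact_mod_cast hℓ
  have hx : 1 / (2 * (ℓ : ℝ)) ≤ 1 / 2 := by
    gcongr
    linarith
  have hbernoulli := one_add_mul_le_pow (a := -(1 / (2 * (ℓ : ℝ)))) (by linarith) ℓ
  rw [← sub_eq_add_neg] at hbernoulli
  have hhalf : 1 + (ℓ : ℝ) * -(1 / (2 * ℓ)) = 1 / 2 := by
    field_simp
    norm_num
  calc (-1 : ℝ) = Real.logb 2 (1 / 2) := by simp [Real.logb_inv]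
    _ ≤ Real.logb 2 ((1 - 1 / (2 * ℓ)) ^ ℓ) := by
        gcongr
        · norm_num
        · linarith
    _ = ℓ * Real.logb 2 (1 - 1 / (2 * ℓ)) := Real.logb_pow _ _ _

-- Discounting every letter by `1 - 1 / (2 * ℓ)` makes the sum over all words converge, and costs
-- at most one bit per `ℓ` letters.
lemma lzCount_mul_logb_le_of_sum_le_one {k ℓ : ℕ} {u : Fin (k * ℓ) → A} (hℓ : 0 < ℓ)
    (hg : ∀ s a, 0 ≤ g s a) (hsum : ∀ s, ∑ a, g s a ≤ 1)
    (hu : 0 < weight next g s (List.ofFn u)) :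
    lzCount u * Real.logb 2 (lzCount u) ≤ -Real.logb 2 (weight next g s (List.ofFn u)) + k
      + lzCount u * Real.logb 2 (2 * ℓ * Fintype.card S + 1) := by
  set β : ℝ := 1 - 1 / (2 * ℓ) with hβ
  have hℓ' : (1 : ℝ) ≤ ℓ := by exact_mod_cast hℓ
  have hβ0 : 0 < β := by
    rw [hβ, sub_pos, div_lt_one (by positivity)]
    linarith
  have hβ1 : β < 1 := sub_lt_self 1 (by positivity)
  have hweight := weight_const_mul next g β s (List.ofFn u)
  have h := lzCount_mul_logb_le_of_sum_le (next := next) (g := fun s a => β * g s a) (u := u)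
    (s := s) (fun s a => mul_nonneg hβ0.le (hg s a))
    (fun s => by
      rw [← Finset.mul_sum]
      exact mul_le_of_le_one_right hβ0.le (hsum s))
    hβ1 (by rw [hweight]; positivity)
  have hcard : Fintype.card S / (1 - β) = 2 * ℓ * Fintype.card S := by
    rw [hβ]
    field_simp
    ring
  rw [hweight, Real.logb_mul (pow_pos hβ0 _).ne' hu.ne', Real.logb_pow, List.length_ofFn, hcard]
    at h
  have hdiscount := mul_le_mul_of_nonneg_left (neg_one_le_mul_logb_one_sub hℓ)
    (Nat.cast_nonneg (α := ℝ) k)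
  push_cast at h
  linarith

lemma lzCount_mul_logb_sub_le [Nonempty A] (u : Fin n → A) :
    lzCount u * (Real.logb 2 (lzCount u) - Real.logb 2 3)
      ≤ (1 + Real.logb 2 (Fintype.card A)) * n := by
  have hJ : (0 : ℝ) < Fintype.card A := by exact_mod_cast Fintype.card_pos
  have hweight := weight_const (fun _ _ => ()) ((2 * Fintype.card A : ℝ)⁻¹) () (List.ofFn u)
  have h := lzCount_mul_logb_le_of_sum_le (β := 1 / 2) (u := u) (s := ())
    (g := fun _ _ => (2 * Fintype.card A : ℝ)⁻¹) (next := fun _ _ => ())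
    (fun _ _ => by positivity)
    (fun _ => by
      rw [Finset.sum_const, Finset.card_univ, nsmul_eq_mul]
      exact le_of_eq (by field_simp))
    (by norm_num) (by rw [hweight]; positivity)
  rw [hweight, Real.logb_pow, Real.logb_inv, Real.logb_mul two_ne_zero hJ.ne',
    Real.logb_self_eq_one one_lt_two, List.length_ofFn] at h
  have hcard : (Fintype.card Unit : ℝ) / (1 - 1 / 2) + 1 = 3 := by norm_num
  rw [hcard] at h
  linarith

end ZivInequality

section BlockAutomaton

variable {k ℓ : ℕ} {U : Type*} {Q : (Fin ℓ → U) → ℝ}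

open scoped Classical in
/-- The probability, under the block law `Q`, that the first `τ` letters are those of `a`. -/
noncomputable def prefixMass [Fintype U] (Q : (Fin ℓ → U) → ℝ) (τ : ℕ) (a : Fin ℓ → U) : ℝ :=
  ∑ b with ∀ j : Fin ℓ, (j : ℕ) < τ → b j = a j, Q b

/-- The transitions of the automaton that remembers the current block: its state is the position
in the block, together with a block whose letters before this position are those read so far. The
letters from this position on are leftovers of the previous block. -/
def blockNext (s : Fin ℓ × (Fin ℓ → U)) (x : U) : Fin ℓ × (Fin ℓ → U) :=
  (⟨(s.1 + 1) % ℓ, Nat.mod_lt _ s.1.pos⟩, Function.update s.2 s.1 x)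

/-- The conditional probability under the block law `Q` of the next letter `x`, given the letters
of the block read so far; it is `0` by `x / 0 = 0` if these have probability `0`. -/
noncomputable def blockWeight [Fintype U] (Q : (Fin ℓ → U) → ℝ) (s : Fin ℓ × (Fin ℓ → U))
    (x : U) : ℝ :=
  prefixMass Q (s.1 + 1) (Function.update s.2 s.1 x) / prefixMass Q s.1 s.2

lemma update_ite_lt (a b : Fin ℓ → U) {τ : ℕ} (hτ : τ < ℓ) :
    Function.update (fun j : Fin ℓ => if (j : ℕ) < τ then b j else a j) ⟨τ, hτ⟩ (b ⟨τ, hτ⟩)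
      = fun j : Fin ℓ => if (j : ℕ) < τ + 1 then b j else a j := by
  ext j
  rcases eq_or_ne j ⟨τ, hτ⟩ with rfl | hne
  · simp
  · have hiff : (j : ℕ) < τ + 1 ↔ (j : ℕ) < τ := by grind
    simp [Function.update_of_ne hne, hiff]

lemma foldl_blockNext_take (hℓ : 0 < ℓ) (a b : Fin ℓ → U) {τ : ℕ} (hτ : τ ≤ ℓ) :
    ((List.ofFn b).take τ).foldl blockNext (⟨0, hℓ⟩, a)
      = (⟨τ % ℓ, Nat.mod_lt _ hℓ⟩, fun j : Fin ℓ => if (j : ℕ) < τ then b j else a j) := by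
  induction τ with
  | zero => simp
  | succ τ ih =>
    rw [List.take_succ_eq_append_getElem (by simpa using hτ), List.foldl_append, ih (by omega)]
    simp [blockNext, Nat.mod_eq_of_lt hτ, update_ite_lt a b hτ]

lemma foldl_blockNext_block (hℓ : 0 < ℓ) (a b : Fin ℓ → U) :
    (List.ofFn b).foldl blockNext (⟨0, hℓ⟩, a) = (⟨0, hℓ⟩, b) := by
  simpa [List.take_of_length_le] using foldl_blockNext_take hℓ a b le_rfl

lemma ofFn_eq_flatten_blocks (u : Fin (k * ℓ) → U) :
    List.ofFn u = ((List.ofFn (block u)).map List.ofFn).flatten := by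
  rw [List.ofFn_mul, List.map_ofFn]
  congr 2
  ext i : 1
  refine congrArg List.ofFn (funext fun j => congrArg u (Fin.ext ?_))
  simp [finProdFinEquiv_apply_val, mul_comm, add_comm]

variable [Fintype U]

lemma prefixMass_nonneg (hQ : ∀ b, 0 ≤ Q b) (τ : ℕ) (a : Fin ℓ → U) : 0 ≤ prefixMass Q τ a :=
  Finset.sum_nonneg fun b _ => hQ b

lemma le_prefixMass (hQ : ∀ b, 0 ≤ Q b) (τ : ℕ) (b : Fin ℓ → U) : Q b ≤ prefixMass Q τ b :=
  Finset.single_le_sum (f := Q) (fun b _ => hQ b) (by simp)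

lemma prefixMass_congr {τ : ℕ} {a b : Fin ℓ → U} (h : ∀ j : Fin ℓ, (j : ℕ) < τ → a j = b j) :
    prefixMass Q τ a = prefixMass Q τ b := by
  classical
  exact Finset.sum_congr (Finset.filter_congr fun c _ =>
    forall₂_congr fun j hj => by rw [h j hj]) fun _ _ => rfl

lemma prefixMass_zero (a : Fin ℓ → U) : prefixMass Q 0 a = ∑ b, Q b := by
  simp [prefixMass]

lemma prefixMass_length (b : Fin ℓ → U) : prefixMass Q ℓ b = Q b := by
  classical
  simp [prefixMass, ← funext_iff, Finset.sum_filter]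

lemma sum_prefixMass_update (τ : Fin ℓ) (a : Fin ℓ → U) :
    ∑ x, prefixMass Q (τ + 1) (Function.update a τ x) = prefixMass Q τ a := by
  classical
  rw [prefixMass, ← Finset.sum_fiberwise (g := fun b : Fin ℓ → U => b τ)]
  refine Finset.sum_congr rfl fun x _ => ?_
  rw [prefixMass, Finset.filter_filter]
  refine Finset.sum_congr (Finset.filter_congr fun b _ => ⟨fun h => ⟨fun j hj => ?_, ?_⟩, ?_⟩)
    fun _ _ => rfl
  · rw [h j (by omega), Function.update_of_ne (Fin.ne_of_lt hj)]
  · rw [h τ (by omega), Function.update_self]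
  · rintro ⟨h, rfl⟩ j hj
    rcases eq_or_ne j τ with rfl | hne
    · rw [Function.update_self]
    · rw [Function.update_of_ne hne]
      exact h j (by have := Fin.val_ne_of_ne hne; omega)

lemma blockWeight_nonneg (hQ : ∀ b, 0 ≤ Q b) (s : Fin ℓ × (Fin ℓ → U)) (x : U) :
    0 ≤ blockWeight Q s x :=
  div_nonneg (prefixMass_nonneg hQ _ _) (prefixMass_nonneg hQ _ _)

lemma sum_blockWeight_le (s : Fin ℓ × (Fin ℓ → U)) : ∑ x, blockWeight Q s x ≤ 1 := by
  simp only [blockWeight, ← Finset.sum_div, sum_prefixMass_update]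
  exact div_self_le_one _

lemma weight_take_block (hQ : Q ∈ stdSimplex ℝ (Fin ℓ → U)) (hℓ : 0 < ℓ) {b : Fin ℓ → U}
    (hb : 0 < Q b) (a : Fin ℓ → U) {τ : ℕ} (hτ : τ ≤ ℓ) :
    weight blockNext (blockWeight Q) (⟨0, hℓ⟩, a) ((List.ofFn b).take τ) = prefixMass Q τ b := by
  induction τ with
  | zero => simp [weight, prefixMass_zero, hQ.2]
  | succ τ ih =>
    have hpos : 0 < prefixMass Q τ b := hb.trans_le (le_prefixMass hQ.1 τ b)
    have hτ' : τ % ℓ = τ := Nat.mod_eq_of_lt hτ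
    rw [List.take_succ_eq_append_getElem (by simpa using hτ), weight_append, ih (by omega),
      foldl_blockNext_take hℓ a b (by omega), weight, weight, mul_one, blockWeight]
    simp only [hτ', List.getElem_ofFn, update_ite_lt a b hτ]
    rw [prefixMass_congr (b := b) fun j hj => if_pos hj,
      prefixMass_congr (b := b) fun j hj => if_pos hj,
      mul_div_cancel₀ _ hpos.ne']

lemma weight_flatten_blocks (hQ : Q ∈ stdSimplex ℝ (Fin ℓ → U)) (hℓ : 0 < ℓ)
    {L : List (Fin ℓ → U)} (hL : ∀ b ∈ L, 0 < Q b) (a : Fin ℓ → U) :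
    weight blockNext (blockWeight Q) (⟨0, hℓ⟩, a) (L.map List.ofFn).flatten = (L.map Q).prod := by
  induction L generalizing a with
  | nil => simp [weight]
  | cons b L ih =>
    obtain ⟨hb, hL⟩ := List.forall_mem_cons.1 hL
    have hblock := weight_take_block hQ hℓ hb a le_rfl
    rw [List.take_of_length_le (by simp), prefixMass_length] at hblock
    rw [List.map_cons, List.flatten_cons, weight_append, hblock, foldl_blockNext_block, ih hL,
      List.map_cons, List.prod_cons]

variable [DecidableEq U]

lemma lzCount_mul_logb_le_sum_logb_block (hℓ : 0 < ℓ) (hQ : Q ∈ stdSimplex ℝ (Fin ℓ → U))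
    {u : Fin (k * ℓ) → U} (hu : ∀ i, 0 < Q (block u i)) :
    lzCount u * Real.logb 2 (lzCount u) ≤ -∑ i, Real.logb 2 (Q (block u i)) + k
      + lzCount u * Real.logb 2 (2 * ℓ ^ 2 * (Fintype.card U : ℝ) ^ ℓ + 1) := by
  obtain ⟨a⟩ : Nonempty (Fin ℓ → U) := by
    by_contra h
    rw [not_nonempty_iff] at h
    simpa using hQ.2
  have hweight : weight blockNext (blockWeight Q) (⟨0, hℓ⟩, a) (List.ofFn u)
      = ∏ i, Q (block u i) := by
    rw [ofFn_eq_flatten_blocks, weight_flatten_blocks hQ hℓ (by simpa [List.mem_ofFn] using hu),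
      List.map_ofFn, List.prod_ofFn]
    rfl
  have h := lzCount_mul_logb_le_of_sum_le_one (u := u) hℓ (blockWeight_nonneg hQ.1)
    sum_blockWeight_le (hweight ▸ Finset.prod_pos fun i _ => hu i)
  rw [hweight, Real.logb_prod _ _ fun i _ => (hu i).ne', Fintype.card_prod, Fintype.card_fun,
    Fintype.card_fin] at h
  convert h using 4
  push_cast
  ring

lemma lzCount_mul_logb_le_blockEntropy (hk : 0 < k) (hℓ : 0 < ℓ) (u : Fin (k * ℓ) → U) :
    lzCount u * Real.logb 2 (lzCount u) ≤ k * blockEntropy u + k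
      + lzCount u * Real.logb 2 (2 * ℓ ^ 2 * (Fintype.card U : ℝ) ^ ℓ + 1) := by
  have hunif := uniform_mem_stdSimplex hk
  have hk' : (0 : ℝ) < k := by exact_mod_cast hk
  have hlaw : ∀ i, 0 < law (fun _ : Fin k => (k : ℝ)⁻¹) (block u) (block u i) := fun i =>
    (inv_pos.2 hk').trans_le (le_law hunif.1 (block u) i)
  refine (lzCount_mul_logb_le_sum_logb_block hℓ (law_mem_stdSimplex hunif (block u))
    hlaw).trans_eq ?_
  rw [blockEntropy, rvEntropy, ← Finset.mul_sum, mul_neg, mul_inv_cancel_left₀ hk'.ne']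

end BlockAutomaton

section Asymptotics

-- Either `c ≤ x ^ θ`, and `c * logb 2 x` is negligible, or `logb 2 c` exceeds `θ * logb 2 x`.
lemma eventually_mul_logb_le {a b κ : ℝ} (ha : 0 < a) (hκ : 1 < κ) :
    ∀ᶠ x : ℝ in Filter.atTop, ∀ c : ℝ, c * (Real.logb 2 c - b) ≤ a * x →
      c * Real.logb 2 x ≤ κ * a * x := by
  obtain ⟨θ, hκθ, hθ⟩ := exists_between (inv_lt_one_of_one_lt₀ hκ)
  have hκ0 : 0 < κ := one_pos.trans hκ
  have hlog2 : 0 < Real.log 2 := Real.log_pos one_lt_two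
  have hsmall : ∀ᶠ x : ℝ in Filter.atTop, Real.logb 2 x ≤ κ * a * x ^ (1 - θ) := by
    filter_upwards [(isLittleO_log_rpow_atTop (sub_pos.2 hθ)).bound
      (c := κ * a * Real.log 2) (by positivity), Filter.eventually_ge_atTop 1] with x hx hx1
    rw [Real.norm_of_nonneg (Real.log_nonneg hx1), Real.norm_of_nonneg (by positivity)] at hx
    rw [Real.logb, div_le_iff₀ hlog2]
    linarith
  filter_upwards [hsmall, Filter.eventually_gt_atTop 1,
    (Real.tendsto_logb_atTop one_lt_two).eventually_ge_atTop (b / (θ - κ⁻¹))]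
    with x hx hx1 hxb c hc
  have hx0 : 0 < x := one_pos.trans hx1
  have hlogx : 0 < Real.logb 2 x := Real.logb_pos one_lt_two hx1
  rcases le_or_gt c (x ^ θ) with hcx | hcx
  · calc c * Real.logb 2 x ≤ x ^ θ * (κ * a * x ^ (1 - θ)) := by gcongr
      _ = κ * a * (x ^ θ * x ^ (1 - θ)) := by ring
      _ = κ * a * x := by rw [← Real.rpow_add hx0, add_sub_cancel, Real.rpow_one]
  · have hc0 : 0 < c := (Real.rpow_pos_of_pos hx0 θ).trans hcx
    have hlogc : θ * Real.logb 2 x ≤ Real.logb 2 c := by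
      rw [← Real.logb_rpow_eq_mul_logb_of_pos hx0]
      exact Real.logb_le_logb_of_le one_lt_two (by positivity) hcx.le
    have hb : κ⁻¹ * Real.logb 2 x ≤ Real.logb 2 c - b := by
      rw [div_le_iff₀ (sub_pos.2 hκθ)] at hxb
      linarith
    calc c * Real.logb 2 x = κ * (c * (κ⁻¹ * Real.logb 2 x)) := by field_simp
      _ ≤ κ * (a * x) :=
          mul_le_mul_of_nonneg_left ((mul_le_mul_of_nonneg_left hb hc0.le).trans hc) hκ0.le
      _ = κ * a * x := by ring

lemma two_mul_sq_add_one_le (ℓ : ℕ) : 2 * (ℓ : ℝ) ^ 2 + 1 ≤ 3 ^ ℓ := by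
  induction ℓ with
  | zero => norm_num
  | succ ℓ ih =>
    have hbernoulli := one_add_mul_le_pow (a := (2 : ℝ)) (by norm_num) ℓ
    rw [show (1 + 2 : ℝ) = 3 by norm_num] at hbernoulli
    rw [pow_succ (3 : ℝ), Nat.cast_succ]
    nlinarith

lemma logb_context_count_le {J : ℕ} (hJ : 0 < J) (ℓ : ℕ) :
    Real.logb 2 (2 * ℓ ^ 2 * (J : ℝ) ^ ℓ + 1) ≤ ℓ * (1.6 * (1 + Real.logb 2 J)) := by
  have hJ' : (1 : ℝ) ≤ J := by exact_mod_cast hJ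
  have hpow : 2 * (ℓ : ℝ) ^ 2 * (J : ℝ) ^ ℓ + 1 ≤ (3 * J) ^ ℓ := by
    have hJℓ : 1 ≤ (J : ℝ) ^ ℓ := one_le_pow₀ hJ'
    have h := mul_le_mul_of_nonneg_right (two_mul_sq_add_one_le ℓ) (zero_le_one.trans hJℓ)
    rw [mul_pow]
    linarith
  have hlog3 : Real.logb 2 3 ≤ 1.6 := by
    rw [Real.logb_le_iff_le_rpow one_lt_two three_pos]
    refine le_of_pow_le_pow_left₀ (n := 5) (by norm_num) (by positivity) ?_
    rw [← Real.rpow_natCast, ← Real.rpow_natCast, ← Real.rpow_mul zero_le_two]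
    norm_num
  calc Real.logb 2 (2 * ℓ ^ 2 * (J : ℝ) ^ ℓ + 1) ≤ Real.logb 2 ((3 * J) ^ ℓ) :=
        Real.logb_le_logb_of_le one_lt_two (by positivity) hpow
    _ = ℓ * (Real.logb 2 3 + Real.logb 2 J) := by
        rw [Real.logb_pow, Real.logb_mul three_ne_zero (by positivity)]
    _ ≤ ℓ * (1.6 * (1 + Real.logb 2 J)) := by
        gcongr
        linarith [logb_two_natCast_nonneg J]

lemma lzCount_mul_logb_le_mul_logb {A : Type*} [DecidableEq A] {n : ℕ} (u : Fin n → A) :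
    lzCount u * Real.logb 2 (lzCount u) ≤ n * Real.logb 2 n := by
  rcases (lzCount u).eq_zero_or_pos with hc | hc
  · rw [hc, Nat.cast_zero, zero_mul]
    exact mul_nonneg n.cast_nonneg (logb_two_natCast_nonneg n)
  · have hcn : (lzCount u : ℝ) ≤ n := by exact_mod_cast lzCount_le u
    exact mul_le_mul hcn (Real.logb_le_logb_of_le one_lt_two (Nat.cast_pos.2 hc) hcn)
      (logb_two_natCast_nonneg _) n.cast_nonneg

variable {k ℓ : ℕ} {U : Type*} [Fintype U]

lemma lzCount_mul_logb_div_le [DecidableEq U] (u : Fin (k * ℓ) → U)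
    (hn : 2 ≤ k * ℓ) (hcount : lzCount u * Real.logb 2 ((k * ℓ : ℕ) : ℝ)
      ≤ 1.2 * (1 + Real.logb 2 (Fintype.card U)) * (k * ℓ : ℕ)) :
    lzCount u * Real.logb 2 (lzCount u) / (k * ℓ : ℕ) ≤ blockEntropy u / ℓ
      + 2 * ℓ * (1 + Real.logb 2 (Fintype.card U)) ^ 2 / Real.logb 2 ((k * ℓ : ℕ) : ℝ) + 1 / ℓ := by
  have hk : 0 < k := Nat.pos_of_mul_pos_right (by omega : 0 < k * ℓ)
  have hℓ : 0 < ℓ := Nat.pos_of_mul_pos_left (by omega : 0 < k * ℓ)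
  have hcontext := logb_context_count_le
    (Fintype.card_pos_iff.2 ⟨u ⟨0, by omega⟩⟩ : 0 < Fintype.card U) ℓ
  have hLZ := lzCount_mul_logb_le_blockEntropy hk hℓ u
  have hlogn : 0 < Real.logb 2 ((k * ℓ : ℕ) : ℝ) :=
    Real.logb_pos one_lt_two (Nat.one_lt_cast.2 (by omega))
  have hJ : 0 ≤ Real.logb 2 (Fintype.card U) := logb_two_natCast_nonneg _
  set a := 1 + Real.logb 2 (Fintype.card U)
  set n : ℝ := ((k * ℓ : ℕ) : ℝ) with hn_def
  have hn0 : 0 < n := Nat.cast_pos.2 (by omega)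
  have hcount' : lzCount u / n ≤ 1.2 * a / Real.logb 2 n := by
    rwa [div_le_div_iff₀ hn0 hlogn]
  have hcost : lzCount u / n * Real.logb 2 (2 * ℓ ^ 2 * (Fintype.card U : ℝ) ^ ℓ + 1)
      ≤ 2 * ℓ * a ^ 2 / Real.logb 2 n := by
    calc _ ≤ 1.2 * a / Real.logb 2 n * (ℓ * (1.6 * a)) :=
          mul_le_mul hcount' hcontext (Real.logb_nonneg one_lt_two
            (le_add_of_nonneg_left (by positivity))) (by positivity)
      _ = 1.92 * (ℓ * a ^ 2 / Real.logb 2 n) := by ring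
      _ ≤ 2 * (ℓ * a ^ 2 / Real.logb 2 n) := by gcongr; norm_num
      _ = _ := by ring
  calc lzCount u * Real.logb 2 (lzCount u) / n
      ≤ (k * blockEntropy u + k
        + lzCount u * Real.logb 2 (2 * ℓ ^ 2 * (Fintype.card U : ℝ) ^ ℓ + 1)) / n :=
        div_le_div_of_nonneg_right hLZ hn0.le
    _ = blockEntropy u / ℓ + lzCount u / n
        * Real.logb 2 (2 * ℓ ^ 2 * (Fintype.card U : ℝ) ^ ℓ + 1) + 1 / ℓ := by
        have hk' : (k : ℝ) ≠ 0 := by positivity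
        have hℓ' : (ℓ : ℝ) ≠ 0 := by positivity
        rw [hn_def, Nat.cast_mul]
        field_simp
        ring
    _ ≤ blockEntropy u / ℓ + 2 * ℓ * a ^ 2 / Real.logb 2 n + 1 / ℓ := by linarith

lemma exists_isLittleO_lzCount_mul_logb_div_le (J : ℕ) :
    ∃ r : ℕ → ℝ, Asymptotics.IsLittleO Filter.atTop r (fun n : ℕ => 1 / √(n : ℝ)) ∧
      ∀ {U : Type*} [DecidableEq U] [Fintype U] {k ℓ : ℕ} (u : Fin (k * ℓ) → U),
        Fintype.card U = J → 2 ≤ k * ℓ →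
        lzCount u * Real.logb 2 (lzCount u) / (k * ℓ : ℕ) ≤ blockEntropy u / ℓ
          + 2 * ℓ * (1 + Real.logb 2 J) ^ 2 / Real.logb 2 ((k * ℓ : ℕ) : ℝ) + 1 / ℓ
          + r (k * ℓ) := by
  have ha : 0 < 1 + Real.logb 2 J := by linarith [logb_two_natCast_nonneg J]
  obtain ⟨N, hN⟩ := Filter.eventually_atTop.1 (tendsto_natCast_atTop_atTop.eventually
    (eventually_mul_logb_le (b := Real.logb 2 3) ha (κ := 1.2) (by norm_num)))
  refine ⟨fun n => if n < N then Real.logb 2 n else 0, ?_, ?_⟩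
  · refine (Asymptotics.isLittleO_zero _ _).congr' ?_ Filter.EventuallyEq.rfl
    filter_upwards [Filter.eventually_ge_atTop N] with n hn
    rw [if_neg hn.not_gt]
  rintro U _ _ k ℓ u rfl hn
  have hk : 0 < k := Nat.pos_of_mul_pos_right (by omega : 0 < k * ℓ)
  have : Nonempty U := ⟨u ⟨0, by omega⟩⟩
  dsimp only
  split_ifs with hnN
  · have hn0 : (0 : ℝ) < (k * ℓ : ℕ) := Nat.cast_pos.2 (by omega)
    have htrivial : lzCount u * Real.logb 2 (lzCount u) / (k * ℓ : ℕ)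
        ≤ Real.logb 2 ((k * ℓ : ℕ) : ℝ) := by
      rw [div_le_iff₀' hn0]
      exact lzCount_mul_logb_le_mul_logb u
    have hH : 0 ≤ blockEntropy u := by
      rw [blockEntropy, ← entropy_law]
      exact entropy_nonneg (law_mem_stdSimplex (uniform_mem_stdSimplex hk) _)
    have hlogn := logb_two_natCast_nonneg (k * ℓ)
    have : 0 ≤ blockEntropy u / ℓ + 2 * ℓ * (1 + Real.logb 2 (Fintype.card U)) ^ 2
      / Real.logb 2 ((k * ℓ : ℕ) : ℝ) + 1 / ℓ := by positivity
    linarith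
  · rw [add_zero]
    exact lzCount_mul_logb_div_le u hn (hN _ (not_lt.1 hnN) _ (lzCount_mul_logb_sub_le u))

lemma le_delta2 {J K L ℓ n : ℕ} {r ε : ℝ} (hε : ε ∈ Set.Ioo 0 1) (hn : 2 ≤ n) :
    2 * ℓ * (1 + Real.logb 2 J) ^ 2 / Real.logb 2 n + 1 / ℓ + r ≤ delta2 J K L ℓ n r ε := by
  have hJ := logb_two_natCast_nonneg J
  have hL := logb_two_natCast_nonneg L
  have hlogn : 0 < Real.logb 2 n := Real.logb_pos one_lt_two (by exact_mod_cast hn)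
  have hlogε : (1 - ε) * Real.logb 2 n ≤ Real.logb 2 n :=
    mul_le_of_le_one_left hlogn.le (by linarith [hε.1])
  have he : 0 ≤ Real.logb 2 (Real.exp 1) :=
    Real.logb_nonneg one_lt_two (Real.one_le_exp zero_le_one)
  have hmain : 2 * ℓ * (1 + Real.logb 2 J) ^ 2 / Real.logb 2 n
      ≤ 2 * ℓ * (1 + Real.logb 2 J) ^ 2 / ((1 - ε) * Real.logb 2 n) :=
    div_le_div_of_nonneg_left (by positivity) (mul_pos (by linarith [hε.2]) hlogn) hlogε
  have hrest : 0 ≤ ((J : ℝ) * K) ^ ℓ * Real.logb 2 L / √(n : ℝ)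
      + ((J : ℝ) * K * L) ^ ℓ * Real.logb 2 (Real.exp 1) / (2 * n)
      + 2 * ℓ * (J : ℝ) ^ (2 * ℓ) * Real.logb 2 J / n := by positivity
  unfold delta2 delta1
  linarith

lemma tendsto_one_div_add_two :
    Filter.Tendsto (fun n : ℕ => 1 / ((n : ℝ) + 2)) Filter.atTop (nhds 0) :=
  tendsto_const_nhds.div_atTop
    (Filter.tendsto_atTop_add_const_right _ _ tendsto_natCast_atTop_atTop)

lemma one_div_add_two_mem_Ioo (n : ℕ) : 1 / ((n : ℝ) + 2) ∈ Set.Ioo 0 1 := by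
  refine ⟨by positivity, ?_⟩
  rw [div_lt_one (by positivity)]
  linarith [n.cast_nonneg (α := ℝ)]

end Asymptotics

end SemiDet

theorem theorem2 (J : ℕ) :
    ∃ ε : ℕ → ℝ, (∀ n, 0 < ε n ∧ ε n < 1) ∧
      Filter.Tendsto ε Filter.atTop (nhds 0) ∧
      ∀ K L ℓ : ℕ, 0 < ℓ →
        ∃ r : ℕ → ℝ,
          Asymptotics.IsLittleO Filter.atTop r (fun n : ℕ => 1 / √(n : ℝ)) ∧
          ∀ (U X Y Z : Type*) [AddGroup U] [DecidableEq U] [Fintype U] [Fintype X] [Fintype Y]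
            [Fintype Z],
            Fintype.card U = J → Fintype.card X = K → Fintype.card Y = L →
            ∀ (ϱ : U → ℝ), (∀ w, 0 ≤ ϱ w) →
            ∀ (P : X → Y → ℝ), SemiDet.IsChannel P →
            ∀ n : ℕ, 2 ≤ n → ℓ ∣ n →
            ∀ (u : Fin n → U) (enc : (Fin n → U) → Fin n → X)
              (d : ℕ) (D : SemiDet.Decoder Z Y U) (tail : (Fin n → Y) → Fin n → U),
              SemiDet.psi ϱ
                  ((SemiDet.lzCount u : ℝ) * Real.logb 2 (SemiDet.lzCount u) / n
                    - SemiDet.capacity P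
                    - (2 * Real.logb 2 (Fintype.card Z) + d * Real.logb 2 (Fintype.card U)) / ℓ
                    - SemiDet.delta2 J K L ℓ n (r n) (ε n))
                ≤ (((1 / (n : ℝ)) * ∑ t : Fin n,
                    SemiDet.expect P (enc u)
                      (fun y => ϱ (D.recon ℓ d tail y t - u t)) : ℝ) : EReal) := by
  refine ⟨fun n => 1 / (n + 2), SemiDet.one_div_add_two_mem_Ioo, SemiDet.tendsto_one_div_add_two,
    fun K L ℓ hℓ => ?_⟩
  obtain ⟨r, hr, hLZ⟩ := SemiDet.exists_isLittleO_lzCount_mul_logb_div_le J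
  refine ⟨r, hr, ?_⟩
  rintro U X Y Z _ _ _ _ _ _ hU - - ϱ hϱ P hP n hn hdvd u enc d D tail
  obtain ⟨k, rfl⟩ := exists_eq_mul_left_of_dvd hdvd
  have hk : 0 < k := Nat.pos_of_mul_pos_right (by omega : 0 < k * ℓ)
  obtain ⟨q, hq, hdist, hH⟩ := SemiDet.exists_error_law hk hℓ hP u (enc u) d D tail ϱ
  rw [← hdist]
  refine SemiDet.psi_le_of_le_entropy hϱ hq ?_
  have hcount := hLZ u hU hn
  have hδ := SemiDet.le_delta2 (J := J) (K := K) (L := L) (ℓ := ℓ) (r := r (k * ℓ))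
    (SemiDet.one_div_add_two_mem_Ioo (k * ℓ)) hn
  have hblock : SemiDet.blockEntropy u / ℓ ≤ SemiDet.entropy q + SemiDet.capacity P
      + (2 * Real.logb 2 (Fintype.card Z) + d * Real.logb 2 (Fintype.card U)) / ℓ := by
    have hℓ0 : (0 : ℝ) < ℓ := Nat.cast_pos.2 hℓ
    rw [div_le_iff₀ hℓ0, add_mul, div_mul_cancel₀ _ hℓ0.ne']
    linarith [SemiDet.logb_two_natCast_nonneg (Fintype.card Z)]
  linarith
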